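/- Let $K$ be an oriented knot, given by its knot diagrams (considered up to Reidemeister moves), and let $G$ be any based Gauss diagram of $K$. That is, take any diagram of $K$, a generic immersion of the circle to the plane with over- and underpasses, and a base point distinct from the preimages of the double points. The preimages of each double point are joined by an arrow $c$ from the upper to the lower branch, and $c$ carries the local writhe $\varepsilon(c)=\pm1$ of that double point. Let $v_2(K)$ be the Casson knot invariant, i.e. the coefficient of $z^2$ in the Conway polynomial $\nabla_K(z)$, where $\nabla_K(s-s^{-1})\doteq\Delta_K(s^2)$ up to units of $\mathbb Z[s,s^{-1}]$ for the Alexander polynomial $\Delta_K$, and $\nabla_K(0)=1$. Then $$v_2(K)=\sum_{(c_1,c_2)}\varepsilon(c_1)\,\varepsilon(c_2),$$ where the sum is over all pairs of arrows $(c_1,c_2)$ of $G$ whose end points, as one goes along the oriented circle from the base point, are met in the order: head of $c_1$, tail of $c_2$, tail of $c_1$, head of $c_2$. -/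

import Mathlib

open scoped LaurentPolynomial

/-!
Oriented knots are presented by oriented knot diagrams on the sphere, up to Reidemeister moves.
A knot diagram is recorded by its Gauss diagram: the cyclic sequence of passages through the
double points, each marked as upper or lower and with the local writhe of the double point.
Cutting the circle at the base point turns this cyclic sequence into a word.
-/

/-- One passage of the curve through a double point, that is, one end point of an arrow of the
Gauss diagram: the label of the arrow, whether this is the upper passage (the tail of the arrow)
or the lower one (the head of the arrow), and the sign of the double point. -/
structure Passage where
  chord : ℕ
  upper : Bool
  sign : ℤˣ
deriving DecidableEq

/-- The other passage through the same double point: the other end of the arrow. -/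
def Passage.opp (p : Passage) : Passage := ⟨p.chord, !p.upper, p.sign⟩

/-- Renaming of the arrows. -/
def Passage.relabel (f : Equiv.Perm ℕ) (p : Passage) : Passage := ⟨f p.chord, p.upper, p.sign⟩

/-- A based Gauss diagram: the end points of the arrows in the order in which they are met when
the circle is traversed once, along its orientation, from the base point. Each arrow has exactly
two end points, one tail and one head, which carry the same sign. -/
structure GaussDiagram where
  word : List Passage
  nodup : word.Nodup
  opp_mem : ∀ p ∈ word, p.opp ∈ word
  sign_eq : ∀ p ∈ word, ∀ q ∈ word, p.chord = q.chord → p.sign = q.sign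

namespace GaussDiagram

/-! ### Planarity -/

/-- The edge of the diagram arriving at a passage, together with a direction (`1` along the
orientation of the curve, `-1` against it). In the pair `(p, d)` the curve is followed in
direction `d` and is about to go through the passage `p`. The next pair is obtained by turning
left at this double point and going on to the next passage.

At a positive double point the lower branch points to the left of the upper branch and the upper
branch points to the right of the lower branch; at a negative double point it is the other way
round. After the turn the curve is followed in direction `d'` from the passage `p.opp`. -/
def turnLeft (w : List Passage) (x : Passage × ℤˣ) : Passage × ℤˣ :=
  let d' : ℤˣ := x.2 * x.1.sign * (if x.1.upper then 1 else -1)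
  (if d' = 1 then w.formPerm x.1.opp else w.formPerm.symm x.1.opp, d')

/-- The faces (complementary regions) of the curve drawn on the closed oriented surface that the
Gauss diagram determines: the orbits of `turnLeft`. -/
def Face (G : GaussDiagram) : Type :=
  Quot fun x y : {p // p ∈ G.word} × ℤˣ => turnLeft G.word (x.1.1, x.2) = (y.1.1, y.2)

/-- A Gauss diagram is the Gauss diagram of a generic immersion of the circle to the plane
(equivalently, to the sphere) with over- and underpasses. Either it has no arrows, or, with `n`
double points, `2 * n` edges and `F` faces, the Euler characteristic `n - 2 * n + F` is `2`. -/
def IsPlanar (G : GaussDiagram) : Prop :=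
  G.word = [] ∨ 2 * Nat.card G.Face = G.word.length + 4

/-! ### The Alexander polynomial -/

/-- The Alexander matrix of the diagram. There is one generator `x i` for each edge (the edge
arriving at the `i`-th passage) and one relation for each passage:
`x (i + 1) = x i` at an upper passage, and
`x (i + 1) = t ^ ε * x i + (1 - t ^ ε) * x j` at a lower passage with sign `ε`, where the edge `j`
is the one arriving at the upper passage through the same double point. Indices are cyclic. -/
noncomputable def alexanderMatrix (G : GaussDiagram) :
    Matrix (Fin G.word.length) (Fin G.word.length) ℤ[T;T⁻¹] := fun i j =>
  (if j = finRotate _ i then 1 else 0) -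
    if (G.word.get i).upper then (if j = i then 1 else 0)
    else
      (if j = i then LaurentPolynomial.T ((G.word.get i).sign : ℤ) else 0) +
        (if G.word.get j = (G.word.get i).opp then
          1 - LaurentPolynomial.T ((G.word.get i).sign : ℤ) else 0)

/-- The Alexander polynomial of the diagram, up to a unit of `ℤ[t, t⁻¹]`: the minor of the
Alexander matrix obtained by deleting one column and one row, here the column of the edge that
carries the base point and the row of the last passage. -/
noncomputable def alexanderPolynomial (G : GaussDiagram) : ℤ[T;T⁻¹] :=
  Matrix.det (G.alexanderMatrix.submatrix
    (fun i : Fin (G.word.length - 1) => (⟨i.1, by omega⟩ : Fin G.word.length))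
    (fun j : Fin (G.word.length - 1) => (⟨j.1 + 1, by omega⟩ : Fin G.word.length)))

/-- `p` is the Conway polynomial computed from the diagram: `p (s - s⁻¹)` is the Alexander
polynomial at `t = s ^ 2` up to a unit of `ℤ[s, s⁻¹]`, normalized by `p 0 = 1`.
These conditions determine `p`, since `p (s - s⁻¹)` is invariant under `s ↦ -s⁻¹`. -/
def HasConwayPolynomial (G : GaussDiagram) (p : Polynomial ℤ) : Prop :=
  p.eval 0 = 1 ∧
    ∃ u : (ℤ[T;T⁻¹])ˣ,
      Polynomial.aeval (LaurentPolynomial.T 1 - LaurentPolynomial.T (-1) : ℤ[T;T⁻¹]) p =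
        u * LaurentPolynomial.eval₂ (LaurentPolynomial.C : ℤ →+* ℤ[T;T⁻¹])
          (LaurentPolynomial.isUnit_T 2).unit G.alexanderPolynomial

/-! ### The arrow diagram pairing -/

/-- The sum of `ε(c₁) ε(c₂)` over the pairs of arrows `c₁, c₂` whose end points are met from the
base point in the order: head of `c₁`, tail of `c₂`, tail of `c₁`, head of `c₂`.
Here `p` runs over the heads and `q` over the tails, so that each pair is counted once. -/
def pairing (G : GaussDiagram) : ℤ :=
  ∑ p ∈ G.word.toFinset, ∑ q ∈ G.word.toFinset,
    if p.upper = false ∧ q.upper = true ∧ [p, q, p.opp, q.opp].Sublist G.word then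
      (p.sign : ℤ) * (q.sign : ℤ)
    else 0

end GaussDiagram

/-! ### Knots -/

/-- Two consecutive passages: `x` and then `y` if `s = 1`, and `y` and then `x` if `s = -1`. -/
def passagePair (s : ℤˣ) (x y : Passage) : List Passage := if s = 1 then [x, y] else [y, x]

/-- The Reidemeister moves in terms of Gauss words. The words are cyclic (`rotate`), so that it
suffices to describe moves in which the first affected passages stand at the beginning. Moves are
used only between words of planar Gauss diagrams; in particular the labels of arrows that appear
or take part in a move are then automatically distinct and different from all other labels. -/
inductive ReidemeisterMove : List Passage → List Passage → Prop
  /-- Moving the base point. -/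
  | rotate (u v : List Passage) : ReidemeisterMove (u ++ v) (v ++ u)
  /-- Renaming the double points. -/
  | relabel (f : Equiv.Perm ℕ) (w : List Passage) : ReidemeisterMove w (w.map (Passage.relabel f))
  /-- First move: a kink, with an isolated arrow of any direction and sign. -/
  | one (c : ℕ) (o : Bool) (ε : ℤˣ) (w : List Passage) :
      ReidemeisterMove (⟨c, o, ε⟩ :: ⟨c, !o, ε⟩ :: w) w
  /-- Second move: a piece of the curve is pulled over another one, which runs in the same
  direction (`s = 1`) or in the opposite one (`s = -1`); the two double points have opposite
  signs. -/
  | two (c d : ℕ) (ε s : ℤˣ) (u v : List Passage) :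
      ReidemeisterMove
        ([⟨c, true, ε⟩, ⟨d, true, -ε⟩] ++ u ++
          passagePair s ⟨c, false, ε⟩ ⟨d, false, -ε⟩ ++ v)
        (u ++ v)
  /-- Third move, for a top, a middle and a bottom piece of the curve: `a` is the double point of
  top and middle, `b` of top and bottom, `c` of middle and bottom. The move reverses the order of
  the two double points on each of the pieces. The orders `s₁, s₂, s₃` on the top, the middle and
  the bottom piece and the signs satisfy the relations that hold for three directed lines forming
  a triangle. Here the pieces occur in the cyclic order top, middle, bottom. -/
  | three (a b c : ℕ) (εa εb εc s₁ s₂ s₃ : ℤˣ) (u v w : List Passage)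
      (h₁ : s₁ * εb = s₂ * εc) (h₂ : s₃ * εb = s₂ * εa) :
      ReidemeisterMove
        (passagePair s₁ ⟨a, true, εa⟩ ⟨b, true, εb⟩ ++ u ++
          passagePair s₂ ⟨a, false, εa⟩ ⟨c, true, εc⟩ ++ v ++
          passagePair s₃ ⟨b, false, εb⟩ ⟨c, false, εc⟩ ++ w)
        (passagePair (-s₁) ⟨a, true, εa⟩ ⟨b, true, εb⟩ ++ u ++
          passagePair (-s₂) ⟨a, false, εa⟩ ⟨c, true, εc⟩ ++ v ++
          passagePair (-s₃) ⟨b, false, εb⟩ ⟨c, false, εc⟩ ++ w)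
  /-- Third move, with the pieces in the cyclic order top, bottom, middle. -/
  | threeSwap (a b c : ℕ) (εa εb εc s₁ s₂ s₃ : ℤˣ) (u v w : List Passage)
      (h₁ : s₁ * εb = s₂ * εc) (h₂ : s₃ * εb = s₂ * εa) :
      ReidemeisterMove
        (passagePair s₁ ⟨a, true, εa⟩ ⟨b, true, εb⟩ ++ u ++
          passagePair s₃ ⟨b, false, εb⟩ ⟨c, false, εc⟩ ++ v ++
          passagePair s₂ ⟨a, false, εa⟩ ⟨c, true, εc⟩ ++ w)
        (passagePair (-s₁) ⟨a, true, εa⟩ ⟨b, true, εb⟩ ++ u ++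
          passagePair (-s₃) ⟨b, false, εb⟩ ⟨c, false, εc⟩ ++ v ++
          passagePair (-s₂) ⟨a, false, εa⟩ ⟨c, true, εc⟩ ++ w)

/-- An oriented knot diagram (with a base point): a planar Gauss diagram. -/
def KnotDiagram : Type := {G : GaussDiagram // G.IsPlanar}

/-- An oriented knot: a class of knot diagrams with respect to the equivalence relation generated
by the Reidemeister moves. -/
def Knot : Type := Quot fun D E : KnotDiagram => ReidemeisterMove D.1.word E.1.word

/-- `G` is a based Gauss diagram of the knot `K`. -/
def GaussDiagram.IsDiagramOf (G : GaussDiagram) (K : Knot) : Prop :=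
  ∃ h : G.IsPlanar, (Quot.mk _ (⟨G, h⟩ : KnotDiagram) : Knot) = K

namespace Knot

/-- The Conway polynomial of a knot, computed from some diagram of it. (It does not depend on the
diagram.) -/
noncomputable def conwayPolynomial (K : Knot) : Polynomial ℤ :=
  Classical.epsilon fun p => ∃ G : GaussDiagram, G.IsDiagramOf K ∧ G.HasConwayPolynomial p

/-- The Casson knot invariant: the coefficient of `z ^ 2` in the Conway polynomial. -/
noncomputable def casson (K : Knot) : ℤ := K.conwayPolynomial.coeff 2

end Knot

/-! ### Arrow systems -/

/-! The diagram is reduced to two square matrices indexed by its arrows. Each arrow `c` has a loop,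
the signed arc of the curve between its two ends that avoids the base edge. Rewriting the Alexander
relations in terms of jumps at the lower passages leaves a matrix `O(t)` (`overMatrix`) whose
determinant is the Alexander polynomial up to a unit (`exists_alexanderPolynomial_eq`). A similar
rule read at the upper passages gives `U(t)` (`underMatrix`).

In a planar diagram every arrow has index zero, that is, the edges carry an Alexander numbering `ν`.
With a diagonal matrix `W` of weights `± t ^ ν`, suitably shifted, `O W Oᵀ = U W Uᵀ`, because the
difference telescopes along the curve (`overMatrix_mul_transpose`). Hence `det O = ± det U`, and `t
= 1` fixes the sign. The matrix `U` is explicit: `U(t) = D (1 + (1 - t) N)` with `D` the diagonal of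
signs and `N` an integer matrix. For `t = s²` and `z = s - s⁻¹`, both the sum and the product of `1
- s²` and `1 - s⁻²` are `-z²`, so the Conway polynomial satisfies `∇(z)² = det (1 - z² (N + N²))`.
As `∇` is even with `∇(0) = 1`, comparing coefficients of `z²` gives `2 v₂ = -tr (N + N²)`, and the
trace counts the required pairs of arrows, each twice (`trace_underForm`, `coeff_two_eq_pairing`).

It must also be shown that a Conway polynomial exists, which needs the symmetry of `det O` under `t
↦ t⁻¹`. By Euler's formula there are as many regions off the base edge as arrows, and their
boundaries form a basis of the span of the loops over a field. Rescaling each region by a power of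
`t` given by its number carries `U(t)` to `O(t⁻¹)` up to invertible factors (`det_overMatrix_inv`).

Finally, the Conway polynomial of the knot is chosen from some diagram, perhaps not the given one.
This is met by invariance of the pairing under Reidemeister moves, not of the polynomial. With the
base point just before the upper strand of a second or third move, the tails on it come first, while
the pattern starts with a head; those arrows drop out. Moving the base point changes the pairing by
a multiple of the index of an arrow, which is zero. -/

/-- The end points of the arrows of a Gauss diagram as positions `0, …, len - 1` on the circle
cut at the base point. -/
structure ArrowSystem (C : Type*) (len : ℕ) where
  tail : C → ℕ
  head : C → ℕ
  sign : C → ℤˣ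
  tail_injective : Function.Injective tail
  head_injective : Function.Injective head
  tail_ne_head : ∀ c d, tail c ≠ head d
  tail_lt : ∀ c, tail c < len
  head_lt : ∀ c, head c < len
  covers : ∀ i < len, (∃ c, tail c = i) ∨ ∃ c, head c = i

namespace ArrowSystem

variable {C : Type*} {len : ℕ} (S : ArrowSystem C len)

/-- Every position is an end of exactly one arrow. This turns sums over arrows into telescoping sums
along the curve. -/
theorem sum_range [Fintype C] {A : Type*} [AddCommMonoid A] (f : ℕ → A) :
    ∑ i ∈ Finset.range len, f i = ∑ c, (f (S.tail c) + f (S.head c)) := by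
  classical
  have h : Finset.range len = Finset.univ.image S.tail ∪ Finset.univ.image S.head := by
    ext i
    simp only [Finset.mem_range, Finset.mem_union, Finset.mem_image, Finset.mem_univ, true_and]
    constructor
    · exact S.covers i
    · rintro (⟨c, rfl⟩ | ⟨c, rfl⟩)
      · exact S.tail_lt c
      · exact S.head_lt c
  rw [h, Finset.sum_union, Finset.sum_image (fun _ _ _ _ e => S.tail_injective e),
    Finset.sum_image (fun _ _ _ _ e => S.head_injective e), Finset.sum_add_distrib]
  rw [Finset.disjoint_left]
  intro i hi hj
  simp only [Finset.mem_image, Finset.mem_univ, true_and] at hi hj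
  obtain ⟨c, rfl⟩ := hi
  obtain ⟨d, hd⟩ := hj
  exact S.tail_ne_head c d hd.symm

/-- The cycle which follows the curve from the tail of an arrow to its head, as a function on the
edges; the edge `e` is the one arriving at the position `e`. -/
def loop (c : C) (e : ℕ) : ℤ :=
  (if S.tail c < e then 1 else 0) - (if S.head c < e then 1 else 0)

/-- The base edge is both edge `0` and edge `len`, and loops avoid it: if the head precedes the
tail, the loop is minus the arc from head to tail. -/
theorem loop_zero (c : C) : S.loop c 0 = 0 := by simp [loop]

theorem loop_len (c : C) : S.loop c len = 0 := by simp [loop, S.tail_lt, S.head_lt]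

theorem loop_tail_succ [DecidableEq C] (c d : C) :
    S.loop c (S.tail d + 1) = S.loop c (S.tail d) + if c = d then 1 else 0 := by
  have h1 := S.tail_ne_head d c
  have h2 : S.tail c = S.tail d ↔ c = d := S.tail_injective.eq_iff
  unfold loop
  by_cases h : c = d
  · subst h; rw [if_pos rfl]; split_ifs <;> omega
  · have h3 : S.tail c ≠ S.tail d := fun e => h (h2.1 e)
    split_ifs <;> omega

theorem loop_head_succ [DecidableEq C] (c d : C) :
    S.loop c (S.head d + 1) = S.loop c (S.head d) - if c = d then 1 else 0 := by
  have h1 := S.tail_ne_head c d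
  have h2 : S.head c = S.head d ↔ c = d := S.head_injective.eq_iff
  unfold loop
  by_cases h : c = d
  · subst h; rw [if_pos rfl]; split_ifs <;> omega
  · have h3 : S.head c ≠ S.head d := fun e => h (h2.1 e)
    split_ifs <;> omega

/-- A function on the edges satisfying Kirchhoff's law at each double point is a combination of
loops and of the whole curve. -/
theorem eq_sum_loop [Fintype C] {A : Type*} [CommRing A] (X : ℕ → A)
    (hX : ∀ c, X (S.head c + 1) - X (S.head c) = -(X (S.tail c + 1) - X (S.tail c)))
    {e : ℕ} (he : e ≤ len) :
    X e = X 0 + ∑ c, (X (S.tail c + 1) - X (S.tail c)) * (S.loop c e : A) := by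
  have h1 : ∑ i ∈ Finset.range e, (X (i + 1) - X i) =
      ∑ i ∈ Finset.range len, if i < e then X (i + 1) - X i else 0 := by
    rw [← Finset.sum_filter]
    congr 1
    ext i
    simp only [Finset.mem_range, Finset.mem_filter]
    omega
  -- The two ends of an arrow contribute opposite jumps, each present only if that end lies before
  -- `e`; together they are the jump at the tail times the loop.
  rw [Finset.sum_range_sub, S.sum_range] at h1
  rw [← sub_eq_iff_eq_add', h1]
  refine Finset.sum_congr rfl fun c _ => ?_
  rw [hX c]
  unfold loop
  split_ifs <;> push_cast <;> ring

/-! ### The over- and under-colouring matrices and their determinants -/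

section Matrices

variable {R : Type*} [CommRing R]

/-- The matrix of the relations among the jumps at the heads in an over-colouring. -/
def overMatrix (t : R) : Matrix C C R := fun c d =>
  if S.sign d = 1 then (S.loop c (S.head d) : R) - t * S.loop c (S.head d + 1)
  else (S.loop c (S.head d + 1) : R) - t * S.loop c (S.head d)

/-- The matrix of the relations among the jumps at the tails in an under-colouring. -/
def underMatrix (t : R) : Matrix C C R := fun c d =>
  if S.sign d = 1 then (S.loop c (S.tail d + 1) : R) - t * S.loop c (S.tail d)
  else (S.loop c (S.tail d) : R) - t * S.loop c (S.tail d + 1)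

theorem map_overMatrix {R' : Type*} [CommRing R'] (f : R →+* R') (t : R) :
    (S.overMatrix t).map f = S.overMatrix (f t) := by
  ext c d
  simp only [overMatrix, Matrix.map_apply]
  split_ifs <;> simp

theorem map_underMatrix {R' : Type*} [CommRing R'] (f : R →+* R') (t : R) :
    (S.underMatrix t).map f = S.underMatrix (f t) := by
  ext c d
  simp only [underMatrix, Matrix.map_apply]
  split_ifs <;> simp

variable [DecidableEq C]

/-- The diagonal matrix of the signs. -/
def signMatrix (R : Type*) [CommRing R] : Matrix C C R :=
  Matrix.diagonal fun c => ((S.sign c : ℤ) : R)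

/-- At `t = 1` an entry is the jump of a loop across the head of the column arrow, which vanishes
unless the loop is its own. -/
theorem overMatrix_one : S.overMatrix (1 : R) = S.signMatrix R := by
  ext c d
  rw [overMatrix, S.loop_head_succ, signMatrix, Matrix.diagonal_apply]
  rcases Int.units_eq_one_or (S.sign d) with h | h <;> by_cases e : c = d
  · subst e; simp [h]
  · simp [h, e]
  · subst e; simp [h]
  · simp [h, e]

theorem underMatrix_one : S.underMatrix (1 : R) = S.signMatrix R := by
  ext c d
  rw [underMatrix, S.loop_tail_succ, signMatrix, Matrix.diagonal_apply]
  rcases Int.units_eq_one_or (S.sign d) with h | h <;> by_cases e : c = d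
  · subst e; simp [h]
  · simp [h, e]
  · subst e; simp [h]
  · simp [h, e]

theorem signMatrix_mul_self [Fintype C] : S.signMatrix R * S.signMatrix R = 1 := by
  rw [signMatrix, Matrix.diagonal_mul_diagonal, ← Matrix.diagonal_one]
  congr 1
  ext c
  rcases Int.units_eq_one_or (S.sign c) with h | h <;> simp [h]

theorem det_signMatrix [Fintype C] :
    (S.signMatrix R).det = 1 ∨ (S.signMatrix R).det = -1 := by
  have h : (S.signMatrix R).det = (((∏ c, S.sign c : ℤˣ) : ℤ) : R) := by
    rw [signMatrix, Matrix.det_diagonal]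
    push_cast [Units.coe_prod]
    rfl
  rw [h]
  rcases Int.units_eq_one_or (∏ c, S.sign c) with h | h <;> simp [h]

/-- An Alexander numbering of the edges (by the index of the region on the left). Its existence
says that all arrows have index zero. -/
def IsNumbering (ν : ℕ → ℤ) : Prop :=
  (∀ c, ν (S.head c) = ν (S.tail c + 1)) ∧
  (∀ c, ν (S.tail c) = ν (S.tail c + 1) + S.sign c) ∧
  (∀ c, ν (S.head c + 1) = ν (S.tail c + 1) + S.sign c) ∧ ν len = ν 0

variable {S} [Fintype C]

/-- The weights of the arrows in `overMatrix_mul_transpose`. -/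
def weight (S : ArrowSystem C len) (t : Rˣ) (ν : ℕ → ℤ) (c : C) : R :=
  if S.sign c = 1 then ((t ^ ν (S.tail c + 1) : Rˣ) : R)
  else -((t ^ (ν (S.tail c + 1) - 1) : Rˣ) : R)

/-- At each double point the difference of the two sides is `t - 1` times the jumps, at both
passages, of `t ^ ν` times the product of two loops. Summed over arrows this telescopes along the
curve, and loops vanish on the base edge. -/
theorem overMatrix_mul_transpose (t : Rˣ) {ν : ℕ → ℤ} (hν : S.IsNumbering ν) :
    S.overMatrix (t : R) * Matrix.diagonal (S.weight t ν) * (S.overMatrix (t : R)).transpose =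
      S.underMatrix (t : R) * Matrix.diagonal (S.weight t ν) *
        (S.underMatrix (t : R)).transpose := by
  obtain ⟨h1, h2, h3, -⟩ := hν
  ext c d
  rw [Matrix.mul_apply, Matrix.mul_apply]
  simp only [Matrix.mul_diagonal, Matrix.transpose_apply]
  rw [← sub_eq_zero, ← Finset.sum_sub_distrib]
  let g : ℕ → R := fun e => ((t ^ ν e : Rˣ) : R) * S.loop c e * S.loop d e
  have key : ∀ e, S.overMatrix (t : R) c e * S.weight t ν e * S.overMatrix (t : R) d e -
      S.underMatrix (t : R) c e * S.weight t ν e * S.underMatrix (t : R) d e =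
      ((t : R) - 1) * ((g (S.tail e + 1) - g (S.tail e)) + (g (S.head e + 1) - g (S.head e))) := by
    intro e
    simp only [g, overMatrix, underMatrix, weight, h1, h2, h3, S.loop_head_succ, S.loop_tail_succ]
    push_cast
    rcases Int.units_eq_one_or (S.sign e) with h | h
    · simp only [h, if_true, Units.val_one, zpow_add_one, Units.val_mul]
      ring
    · have h' : ((-1 : ℤˣ) = 1) = False := by simp
      have : (t ^ ν (S.tail e + 1) : Rˣ) = t ^ (ν (S.tail e + 1) - 1) * t := by
        rw [← zpow_add_one, sub_add_cancel]
      simp only [h, h', if_false, Units.val_neg, Units.val_one, ← sub_eq_add_neg, this,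
        Units.val_mul]
      ring
  rw [Finset.sum_congr rfl fun e _ => key e, ← Finset.mul_sum,
    ← S.sum_range fun i => g (i + 1) - g i, Finset.sum_range_sub]
  simp [g, loop_zero, loop_len]

theorem det_overMatrix_sq [IsDomain R] (t : Rˣ) {ν : ℕ → ℤ} (hν : S.IsNumbering ν) :
    (S.overMatrix (t : R)).det ^ 2 = (S.underMatrix (t : R)).det ^ 2 := by
  have h := congrArg Matrix.det (S.overMatrix_mul_transpose t hν)
  simp only [Matrix.det_mul, Matrix.det_transpose, Matrix.det_diagonal] at h
  have h0 : ∏ c, S.weight t ν c ≠ 0 := by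
    rw [Finset.prod_ne_zero_iff]
    intro c _
    unfold weight
    split_ifs
    · exact Units.ne_zero _
    · exact neg_ne_zero.2 (Units.ne_zero _)
  apply mul_right_cancel₀ h0
  linear_combination h

/-- For arrows of index zero the over- and the under-colouring matrices have the same
determinant. -/
theorem det_overMatrix {ν : ℕ → ℤ} (hν : S.IsNumbering ν) :
    (S.overMatrix (LaurentPolynomial.T 1 : ℤ[T;T⁻¹])).det =
      (S.underMatrix (LaurentPolynomial.T 1 : ℤ[T;T⁻¹])).det := by
  have h := S.det_overMatrix_sq (LaurentPolynomial.isUnit_T (R := ℤ) 1).unit hν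
  rw [sq_eq_sq_iff_eq_or_eq_neg] at h
  -- The sign is decided at `t = 1`, where both matrices become the sign matrix, of determinant
  -- `±1`.
  refine h.resolve_right fun h => ?_
  have h' := congrArg (LaurentPolynomial.eval₂ (RingHom.id ℤ) 1) h
  simp only [IsUnit.unit_spec, map_neg, RingHom.map_det, RingHom.mapMatrix_apply, map_overMatrix,
    map_underMatrix, LaurentPolynomial.eval₂_T, one_zpow, Units.val_one, overMatrix_one,
    underMatrix_one] at h'
  rcases S.det_signMatrix (R := ℤ) with h1 | h1 <;> rw [h1] at h' <;> norm_num at h'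

/-! ### The second coefficient -/

/-- The sum of the products of signs over pairs of arrows met in the order head of the first,
tail of the second, tail of the first, head of the second. -/
def pairing (S : ArrowSystem C len) : ℤ := ∑ c, ∑ d,
  if S.head c < S.tail d ∧ S.tail d < S.tail c ∧ S.tail c < S.head d then
    (S.sign c * S.sign d : ℤ) else 0

/-- The matrix `N` with `S.underMatrix t = D (1 + (1 - t) N)`, where `D` is the sign matrix. -/
def underForm (S : ArrowSystem C len) : Matrix C C ℤ := fun c d =>
  S.sign c * (if S.sign d = 1 then S.loop c (S.tail d) else S.loop c (S.tail d + 1))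

theorem underMatrix_eq (t : R) :
    S.underMatrix t = S.signMatrix R * (1 + (1 - t) • S.underForm.map (Int.cast : ℤ → R)) := by
  ext c d
  rw [signMatrix, Matrix.diagonal_mul]
  simp only [underMatrix, underForm, Matrix.add_apply, Matrix.smul_apply, Matrix.map_apply,
    Matrix.one_apply, S.loop_tail_succ, smul_eq_mul]
  rcases Int.units_eq_one_or (S.sign c) with h | h <;>
  rcases Int.units_eq_one_or (S.sign d) with h' | h' <;> by_cases e : c = d
  all_goals first | (subst e; simp_all; done) | (subst e; simp [h]; ring) | (simp [h, h', e]; ring)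

/-- The trace is the sum of `N c d * (1 + N) d c`. Diagonal terms vanish since `N c c` is `0` or
`-1`. Off the diagonal the product of the two loops, each taken at the other's tail, is nonzero only
if both tails lie between a head of one arrow on the left and a head of the other on the right, in
the order of the pattern; it is then `-1`. Each such pair occurs as `(c, d)` and as `(d, c)`. -/
theorem trace_underForm :
    (S.underForm + S.underForm * S.underForm).trace = -2 * S.pairing := by
  have h1 : S.underForm + S.underForm * S.underForm = S.underForm * (1 + S.underForm) := by
    rw [mul_add, mul_one]
  let f : C → C → ℤ := fun c d =>
    if S.head c < S.tail d ∧ S.tail d < S.tail c ∧ S.tail c < S.head d then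
      (S.sign c * S.sign d : ℤ) else 0
  have h2 : ∀ c d, S.underForm c d * (1 + S.underForm) d c = -f c d - f d c := by
    intro c d
    simp only [f, underForm, Matrix.add_apply, Matrix.one_apply, S.loop_tail_succ]
    by_cases e : c = d
    · subst e
      have := S.tail_ne_head c c
      unfold loop
      rcases Int.units_eq_one_or (S.sign c) with h | h <;> simp [h] <;> split_ifs <;> omega
    · have e' : d ≠ c := fun h => e h.symm
      simp only [e, e', if_false, add_zero, ite_self, zero_add]
      have a1 : S.tail c ≠ S.tail d := fun h => e (S.tail_injective h)
      have a2 := S.tail_ne_head c d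
      have a3 := S.tail_ne_head d c
      have a4 : S.head c ≠ S.head d := fun h => e (S.head_injective h)
      have a5 := S.tail_ne_head c c
      have a6 := S.tail_ne_head d d
      have : S.loop c (S.tail d) * S.loop d (S.tail c) =
          -(if S.head c < S.tail d ∧ S.tail d < S.tail c ∧ S.tail c < S.head d then 1 else 0) -
          (if S.head d < S.tail c ∧ S.tail c < S.tail d ∧ S.tail d < S.head c then 1 else 0) := by
        unfold loop
        split_ifs <;> omega
      calc _ = (S.sign c * S.sign d : ℤ) * (S.loop c (S.tail d) * S.loop d (S.tail c)) := by ring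
        _ = _ := by
          rw [this, mul_comm (S.sign d : ℤ)]
          split_ifs <;> ring
  rw [h1, Matrix.trace]
  simp only [Matrix.diag_apply, Matrix.mul_apply, h2, Finset.sum_sub_distrib, Finset.sum_neg_distrib]
  rw [Finset.sum_comm (f := fun x x_1 => f x_1 x), pairing]
  ring

end Matrices

end ArrowSystem

/-! ### Regions of a planar diagram -/

/-- The regions of the diagram: those on the left and on the right of each edge, with the
coincidences at the double points. -/
structure RegionSystem {C : Type*} {len : ℕ} (S : ArrowSystem C len) (F : Type*) where
  left : ℕ → F
  right : ℕ → F
  left_len : left len = left 0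
  right_len : right len = right 0
  positive : ∀ c, S.sign c = 1 → left (S.tail c) = left (S.head c + 1) ∧
    right (S.tail c + 1) = right (S.head c) ∧ left (S.head c) = right (S.tail c) ∧
    right (S.head c + 1) = left (S.tail c + 1)
  negative : ∀ c, S.sign c = -1 → left (S.tail c) = right (S.head c) ∧
    right (S.tail c + 1) = left (S.head c + 1) ∧ left (S.head c) = left (S.tail c + 1) ∧
    right (S.head c + 1) = right (S.tail c)
  covers : ∀ f, ∃ e ≤ len, f = left e ∨ f = right e

namespace RegionSystem

variable {C : Type*} {len : ℕ} {S : ArrowSystem C len} {F : Type*} (D : RegionSystem S F)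

/-- The boundary of a combination of regions, as a function on the edges. -/
def boundary {A : Type*} [CommRing A] (φ : F → A) (e : ℕ) : A := φ (D.left e) - φ (D.right e)

variable {A : Type*} [CommRing A]

/-- The boundary of a combination of regions is a cycle: at a double point each of the four regions
enters the sum of the two jumps twice, with opposite signs. -/
theorem boundary_jump (φ : F → A) (c : C) :
    D.boundary φ (S.head c + 1) - D.boundary φ (S.head c) =
      -(D.boundary φ (S.tail c + 1) - D.boundary φ (S.tail c)) := by
  unfold boundary
  rcases Int.units_eq_one_or (S.sign c) with h | h
  · obtain ⟨h1, h2, h3, h4⟩ := D.positive c h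
    rw [h1, h2, h3, h4]; ring
  · obtain ⟨h1, h2, h3, h4⟩ := D.negative c h
    rw [h1, h2, h3, h4]; ring

theorem boundary_eq [Fintype C] (φ : F → A) {e : ℕ} (he : e ≤ len) :
    D.boundary φ e = D.boundary φ 0 +
      ∑ c, (D.boundary φ (S.tail c + 1) - D.boundary φ (S.tail c)) * (S.loop c e : A) :=
  S.eq_sum_loop _ (D.boundary_jump φ) he

include D in
-- With zero boundary the values agree across each edge, hence on all four regions at a double
-- point.
theorem left_succ_of_boundary_eq_zero {φ : F → A} (h : ∀ e ≤ len, D.boundary φ e = 0) (c : C) :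
    φ (D.left (S.tail c + 1)) = φ (D.left (S.tail c)) ∧
      φ (D.left (S.head c + 1)) = φ (D.left (S.head c)) := by
  have h' : ∀ e ≤ len, φ (D.left e) = φ (D.right e) := fun e he => sub_eq_zero.1 (h e he)
  have a1 := h' _ (S.tail_lt c).le
  have a2 := h' _ (S.tail_lt c)
  have a3 := h' _ (S.head_lt c).le
  have a4 := h' _ (S.head_lt c)
  rcases Int.units_eq_one_or (S.sign c) with h | h
  · obtain ⟨h1, h2, h3, h4⟩ := D.positive c h
    simp_all
  · obtain ⟨h1, h2, h3, h4⟩ := D.negative c h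
    simp_all

/-- The jumps at the tails and the value on the base edge determine the boundary. If it vanishes,
the values stay constant while walking along the curve, which touches every region. -/
theorem eq_zero_of_jumps [Fintype C] {φ : F → A}
    (h : ∀ c, D.boundary φ (S.tail c + 1) - D.boundary φ (S.tail c) = 0)
    (hl : φ (D.left 0) = 0) (hr : φ (D.right 0) = 0) : φ = 0 := by
  have hb : ∀ e ≤ len, D.boundary φ e = 0 := by
    intro e he
    rw [D.boundary_eq φ he]
    simp only [h, zero_mul, Finset.sum_const_zero, add_zero]
    rw [boundary, hl, hr, sub_zero]
  have hleft : ∀ e ≤ len, φ (D.left e) = 0 := by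
    intro e
    induction e with
    | zero => intro _; exact hl
    | succ e ih =>
      intro he
      have := ih (by omega)
      rcases S.covers e (by omega) with ⟨c, rfl⟩ | ⟨c, rfl⟩
      · rw [(D.left_succ_of_boundary_eq_zero hb c).1, this]
      · rw [(D.left_succ_of_boundary_eq_zero hb c).2, this]
  funext f
  obtain ⟨e, he, rfl | rfl⟩ := D.covers f
  · exact hleft e he
  · have := hb e he
    rw [boundary, hleft e he, zero_sub, neg_eq_zero] at this
    exact this

/-- The jumps of the boundary at the tails, together with the values at the two regions along the
base edge. -/
def coordinates (K : Type*) [Field K] : (F → K) →ₗ[K] (C → K) × K × K where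
  toFun φ := (fun c => D.boundary φ (S.tail c + 1) - D.boundary φ (S.tail c),
    φ (D.left 0), φ (D.right 0))
  map_add' φ ψ := by
    ext <;> simp [boundary]
    ring
  map_smul' a φ := by
    ext <;> simp [boundary]
    ring

theorem coordinates_injective [Fintype C] (K : Type*) [Field K] :
    Function.Injective (D.coordinates K) := by
  rw [← LinearMap.ker_eq_bot, LinearMap.ker_eq_bot']
  intro φ h
  simp only [coordinates, LinearMap.coe_mk, AddHom.coe_mk, Prod.mk_eq_zero] at h
  exact D.eq_zero_of_jumps (fun c => congrFun h.1 c) h.2.1 h.2.2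

/-- Euler's formula gives the two spaces equal dimension, so injectivity suffices. -/
theorem coordinates_surjective [Fintype C] [Fintype F] (hF : Fintype.card F = Fintype.card C + 2)
    (K : Type*) [Field K] : Function.Surjective (D.coordinates K) := by
  refine (LinearMap.injective_iff_surjective_of_finrank_eq_finrank ?_).1
    (D.coordinates_injective K)
  simp [hF]

/-- An Alexander numbering of the regions. -/
def IsNumbering (m : F → ℤ) : Prop :=
  m (D.right 0) = 0 ∧ ∀ e ≤ len, m (D.left e) = m (D.right e) + 1

theorem exists_numbering [Fintype C] [Fintype F] (hF : Fintype.card F = Fintype.card C + 2) :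
    ∃ m : F → ℤ, D.IsNumbering m := by
  -- No jumps, and values `1` and `0` to the left and right of the base edge: the boundary is the
  -- whole curve. The solution is rational at first; integrality follows by walking along the curve,
  -- where the value on the left changes by `±1` at each passage.
  obtain ⟨q, hq⟩ := D.coordinates_surjective hF ℚ (0, 1, 0)
  simp only [coordinates, LinearMap.coe_mk, AddHom.coe_mk, Prod.mk.injEq] at hq
  obtain ⟨h1, h2, h3⟩ := hq
  have hb : ∀ e ≤ len, q (D.left e) = q (D.right e) + 1 := by
    intro e he
    have := D.boundary_eq q he
    simp only [fun c => congrFun h1 c, Pi.zero_apply, zero_mul, Finset.sum_const_zero,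
      add_zero] at this
    rw [boundary, boundary, h2, h3] at this
    linarith
  have hint : ∀ e ≤ len, ∃ k : ℤ, q (D.left e) = k := by
    intro e
    induction e with
    | zero => intro _; exact ⟨1, by simp [h2]⟩
    | succ e ih =>
      intro he
      obtain ⟨k, hk⟩ := ih (by omega)
      have step : ∀ c, (S.tail c = e ∨ S.head c = e) →
          (q (D.left (e + 1)) = q (D.left e) + 1 ∨ q (D.left (e + 1)) = q (D.left e) - 1) := by
        intro c hc
        have a1 := hb _ (S.tail_lt c).le
        have a2 := hb _ (S.tail_lt c)
        have a3 := hb _ (S.head_lt c).le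
        have a4 := hb _ (S.head_lt c)
        rcases Int.units_eq_one_or (S.sign c) with h | h
        · obtain ⟨b1, b2, b3, b4⟩ := D.positive c h
          rw [b1] at a1; rw [b2] at a2; rw [b3] at a3; rw [b4] at a4
          rcases hc with rfl | rfl
          · right; rw [b1]; linarith
          · left; rw [b3]; linarith
        · obtain ⟨b1, b2, b3, b4⟩ := D.negative c h
          rw [b1] at a1; rw [b2] at a2; rw [b3] at a3; rw [b4] at a4
          rcases hc with rfl | rfl
          · left; rw [b1]; linarith
          · right; rw [b3]; linarith
      have : q (D.left (e + 1)) = q (D.left e) + 1 ∨ q (D.left (e + 1)) = q (D.left e) - 1 := by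
        rcases S.covers e (by omega) with ⟨c, hc⟩ | ⟨c, hc⟩
        · exact step c (Or.inl hc)
        · exact step c (Or.inr hc)
      rcases this with h | h
      · exact ⟨k + 1, by rw [h, hk]; push_cast; ring⟩
      · exact ⟨k - 1, by rw [h, hk]; push_cast; ring⟩
  have hint' : ∀ f, ∃ k : ℤ, q f = k := by
    intro f
    obtain ⟨e, he, rfl | rfl⟩ := D.covers f
    · exact hint e he
    · obtain ⟨k, hk⟩ := hint e he
      exact ⟨k - 1, by have := hb e he; push_cast; linarith⟩
  choose m hm using hint'
  refine ⟨m, ?_, fun e he => ?_⟩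
  · have := hm (D.right 0)
    rw [h3] at this
    exact_mod_cast this.symm
  · have := hb e he
    rw [hm, hm] at this
    exact_mod_cast this

variable {D} in
theorem IsNumbering.isNumbering {m : F → ℤ} (hm : D.IsNumbering m) :
    S.IsNumbering fun e => m (D.left e) := by
  have key : ∀ c, m (D.left (S.head c)) = m (D.left (S.tail c + 1)) ∧
      m (D.left (S.tail c)) = m (D.left (S.tail c + 1)) + S.sign c ∧
      m (D.left (S.head c + 1)) = m (D.left (S.tail c + 1)) + S.sign c := by
    intro c
    have a1 := hm.2 _ (S.tail_lt c).le
    have a2 := hm.2 (S.tail c + 1) (S.tail_lt c)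
    have a3 := hm.2 _ (S.head_lt c).le
    have a4 := hm.2 (S.head c + 1) (S.head_lt c)
    rcases Int.units_eq_one_or (S.sign c) with h | h
    · obtain ⟨b1, b2, b3, b4⟩ := D.positive c h
      rw [h, Units.val_one]
      apply_fun m at b1 b2 b3 b4
      omega
    · obtain ⟨b1, b2, b3, b4⟩ := D.negative c h
      rw [h, Units.val_neg, Units.val_one]
      apply_fun m at b1 b2 b3 b4
      omega
  exact ⟨fun c => (key c).1, fun c => (key c).2.1, fun c => (key c).2.2,
    congrArg m D.left_len⟩

/-! ### Inversion of the variable, by means of regions -/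

section Duality

variable {K : Type*} [Field K]

/-- The over-matrix with the roles of the two sides of each double point exchanged. -/
def _root_.ArrowSystem.overMatrixFlip (S : ArrowSystem C len) (t : K) : Matrix C C K := fun c d =>
  if S.sign d = 1 then (S.loop c (S.head d + 1) : K) - t * S.loop c (S.head d)
  else (S.loop c (S.head d) : K) - t * S.loop c (S.head d + 1)

theorem _root_.ArrowSystem.overMatrixFlip_eq (S : ArrowSystem C len) {t : K} (ht : t ≠ 0) :
    S.overMatrixFlip t = (-t) • S.overMatrix t⁻¹ := by
  ext c d
  simp only [ArrowSystem.overMatrixFlip, ArrowSystem.overMatrix, Matrix.smul_apply, smul_eq_mul]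
  split_ifs <;> field_simp <;> ring

/-- The regions away from the base edge. -/
abbrev Inner : Type _ := {f : F // f ≠ D.left 0 ∧ f ≠ D.right 0}

/-- Combinations of regions away from the base edge. -/
noncomputable def extend (φ : D.Inner → K) (f : F) : K :=
  open Classical in if h : f ≠ D.left 0 ∧ f ≠ D.right 0 then φ ⟨f, h⟩ else 0

/-- The matrix expressing a combination of regions away from the base edge by loops. -/
noncomputable def loopMatrix (K : Type*) [Field K] : Matrix C D.Inner K :=
  open Classical in fun c f =>
    D.boundary (fun g => if g = f.1 then (1 : K) else 0) (S.tail c + 1) -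
      D.boundary (fun g => if g = f.1 then (1 : K) else 0) (S.tail c)

theorem loopMatrix_mulVec [Fintype D.Inner]
    (φ : D.Inner → K) (c : C) :
    (D.loopMatrix K).mulVec φ c =
      D.boundary (D.extend φ) (S.tail c + 1) - D.boundary (D.extend φ) (S.tail c) := by
  classical
  have h : ∀ g, D.extend φ g = ∑ f, (if g = f.1 then (1 : K) else 0) * φ f := by
    intro g
    unfold extend
    split_ifs with hg
    · rw [Finset.sum_eq_single ⟨g, hg⟩]
      · simp
      · intro b _ hb
        rw [if_neg, zero_mul]
        rintro rfl
        exact hb rfl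
      · simp
    · symm
      apply Finset.sum_eq_zero
      intro f _
      rw [if_neg, zero_mul]
      rintro rfl
      exact hg f.2
  simp only [Matrix.mulVec, dotProduct, loopMatrix, boundary, h, ← Finset.sum_sub_distrib,
    ← sub_mul]

theorem boundary_extend [Fintype C] [Fintype D.Inner]
    (φ : D.Inner → K) {e : ℕ} (he : e ≤ len) :
    D.boundary (D.extend φ) e = ∑ c, (D.loopMatrix K).mulVec φ c * S.loop c e := by
  have h0 : D.boundary (D.extend φ) 0 = 0 := by simp [boundary, extend]
  rw [D.boundary_eq _ he, h0, zero_add]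
  simp only [loopMatrix_mulVec]

variable {D} in
-- Applied to boundaries of regions, each row is a relation among the values on the four regions at
-- a double point. Their numbers are such that the factors `t ^ m` turn the relation at the upper
-- passage into the flipped one at the lower passage, up to the common factor `-t ^ min`.
theorem IsNumbering.overMatrixFlip_mul [Fintype C] [DecidableEq C] [Fintype D.Inner]
    [DecidableEq D.Inner]
    {m : F → ℤ} (hm : D.IsNumbering m) {t : K} (ht : t ≠ 0) :
    (S.overMatrixFlip t).transpose * D.loopMatrix K *
        Matrix.diagonal (fun f : D.Inner => t ^ m f.1) =
      Matrix.diagonal (fun c => -t ^ min (m (D.left (S.tail c))) (m (D.left (S.tail c + 1)))) *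
        ((S.underMatrix t).transpose * D.loopMatrix K) := by
  apply Matrix.toLin'.injective
  apply LinearMap.ext
  intro φ
  simp only [Matrix.toLin'_apply, ← Matrix.mulVec_mulVec]
  funext d
  rw [Matrix.mulVec_diagonal]
  set ψ := (Matrix.diagonal fun f : D.Inner =>
    t ^ m f.1).mulVec φ with hψ
  have hext : ∀ f, D.extend ψ f = t ^ m f * D.extend φ f := by
    intro f
    unfold extend
    split_ifs with h
    · rw [hψ, Matrix.mulVec_diagonal]
    · simp
  have e1 : (S.overMatrixFlip t).transpose.mulVec ((D.loopMatrix K).mulVec ψ) d =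
      if S.sign d = 1 then
        D.boundary (D.extend ψ) (S.head d + 1) - t * D.boundary (D.extend ψ) (S.head d)
      else D.boundary (D.extend ψ) (S.head d) - t * D.boundary (D.extend ψ) (S.head d + 1) := by
    rw [D.boundary_extend ψ (S.head_lt d), D.boundary_extend ψ (S.head_lt d).le, Matrix.mulVec,
      dotProduct]
    simp only [Matrix.transpose_apply, ArrowSystem.overMatrixFlip]
    split_ifs <;> simp only [Finset.mul_sum, ← Finset.sum_sub_distrib] <;>
      exact Finset.sum_congr rfl fun c _ => by ring
  have e2 : (S.underMatrix t).transpose.mulVec ((D.loopMatrix K).mulVec φ) d =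
      if S.sign d = 1 then
        D.boundary (D.extend φ) (S.tail d + 1) - t * D.boundary (D.extend φ) (S.tail d)
      else D.boundary (D.extend φ) (S.tail d) - t * D.boundary (D.extend φ) (S.tail d + 1) := by
    rw [D.boundary_extend φ (S.tail_lt d), D.boundary_extend φ (S.tail_lt d).le, Matrix.mulVec,
      dotProduct]
    simp only [Matrix.transpose_apply, ArrowSystem.underMatrix]
    split_ifs <;> simp only [Finset.mul_sum, ← Finset.sum_sub_distrib] <;>
      exact Finset.sum_congr rfl fun c _ => by ring
  rw [e1, e2]
  have a1 := hm.2 _ (S.tail_lt d).le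
  have a2 := hm.2 (S.tail d + 1) (S.tail_lt d)
  have a3 := hm.isNumbering.2.1 d
  simp only at a3
  unfold boundary
  simp only [hext]
  rcases Int.units_eq_one_or (S.sign d) with h | h
  · obtain ⟨b1, b2, b3, b4⟩ := D.positive d h
    rw [h, Units.val_one] at a3
    rw [if_pos h, if_pos h, min_eq_right (by omega), ← b1, ← b2, b3, b4]
    have c1 : m (D.right (S.tail d + 1)) = m (D.right (S.tail d)) - 1 := by omega
    have c2 : m (D.left (S.tail d)) = m (D.right (S.tail d)) + 1 := by omega
    have c3 : m (D.left (S.tail d + 1)) = m (D.right (S.tail d)) := by omega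
    rw [c1, c2, c3, zpow_add_one₀ ht, zpow_sub_one₀ ht]
    field_simp
    ring
  · have h' : ¬ S.sign d = 1 := by rw [h]; decide
    obtain ⟨b1, b2, b3, b4⟩ := D.negative d h
    rw [h, Units.val_neg, Units.val_one] at a3
    rw [if_neg h', if_neg h', min_eq_left (by omega), ← b1, ← b2, b3, b4]
    have c1 : m (D.right (S.tail d + 1)) = m (D.right (S.tail d)) + 1 := by omega
    have c2 : m (D.left (S.tail d)) = m (D.right (S.tail d)) + 1 := by omega
    have c3 : m (D.left (S.tail d + 1)) = m (D.right (S.tail d)) + 1 + 1 := by omega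
    rw [c1, c2, c3, zpow_add_one₀ ht, zpow_add_one₀ ht]
    ring

/-- For a planar diagram, inverting the variable of the over-colouring matrix gives the
determinant of the under-colouring matrix up to a unit. -/
theorem det_overMatrix_inv [Fintype C] [DecidableEq C] [Fintype F] (hF : Fintype.card F = Fintype.card C + 2)
    {m : F → ℤ} (hm : D.IsNumbering m) {t : K} (ht : t ≠ 0) :
    ∃ (k : ℤ) (σ : ℤˣ), (S.overMatrix t⁻¹).det = ((σ : ℤ) : K) * t ^ k * (S.underMatrix t).det := by
  classical
  have hne : D.left 0 ≠ D.right 0 := by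
    intro h
    have := hm.2 0 (Nat.zero_le _)
    rw [h] at this
    omega
  have hcard : Fintype.card D.Inner = Fintype.card C := by
    rw [Fintype.card_subtype]
    have : Finset.univ.filter (fun f => f ≠ D.left 0 ∧ f ≠ D.right 0) =
        (Finset.univ.erase (D.left 0)).erase (D.right 0) := by
      ext f; simp [and_comm]
    rw [this, Finset.card_erase_of_mem (by simp [hne.symm]), Finset.card_erase_of_mem (by simp),
      Finset.card_univ, hF]
    rfl
  let e := Fintype.equivOfCardEq hcard
  -- Deleting the two distinct regions along the base edge leaves as many regions as arrows, so the
  -- loop matrix becomes square; it is invertible by `eq_zero_of_jumps`.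
  let Q : Matrix C C K := (D.loopMatrix K).submatrix id e.symm
  have hQ : Q.det ≠ 0 := by
    intro h
    obtain ⟨v, hv, hv'⟩ := Matrix.exists_mulVec_eq_zero_iff.2 h
    apply hv
    have h1 : (D.loopMatrix K).mulVec (v ∘ e) = 0 := by
      rw [← hv']
      funext c
      simp only [Matrix.mulVec, dotProduct, Q, Matrix.submatrix_apply, id, Function.comp]
      exact Fintype.sum_equiv e _ _ fun f => by simp
    have h2 := D.eq_zero_of_jumps (φ := D.extend (v ∘ e))
      (fun c => by rw [← loopMatrix_mulVec, h1]; rfl) (by simp [extend]) (by simp [extend])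
    funext c
    have h3 := congrFun h2 (e.symm c).1
    simpa [extend, (e.symm c).2] using h3
  have h := congrArg (fun M => (M.submatrix id e.symm).det) (hm.overMatrixFlip_mul (K := K) ht)
  have hd : (Matrix.diagonal fun f : D.Inner =>
      t ^ m f.1).submatrix e.symm e.symm = Matrix.diagonal fun c => t ^ m (e.symm c).1 := by
    rw [Matrix.submatrix_diagonal_equiv]
    rfl
  have h1 : ∀ P : Matrix C C K, (P * D.loopMatrix K).submatrix id e.symm = P * Q := by
    intro P
    rfl
  have h2 : ((S.overMatrixFlip t).transpose * D.loopMatrix K *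
        Matrix.diagonal (fun f : D.Inner => t ^ m f.1)).submatrix id e.symm =
      (S.overMatrixFlip t).transpose * Q * Matrix.diagonal fun c => t ^ m (e.symm c).1 := by
    rw [← hd, ← h1, ← Matrix.submatrix_mul_equiv _ _ id e.symm e.symm]
  rw [h2] at h
  have h3 : ∀ P : Matrix C C K, (P * ((S.underMatrix t).transpose * D.loopMatrix K)).submatrix
      id e.symm = P * ((S.underMatrix t).transpose * Q) := fun P => rfl
  simp only [h3, Matrix.det_mul, Matrix.det_transpose, Matrix.det_diagonal,
    S.overMatrixFlip_eq ht, Matrix.det_smul] at h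
  have hprod : ∀ {ι : Type _} (s : Finset ι) (f : ι → ℤ), ∏ i ∈ s, t ^ f i = t ^ ∑ i ∈ s, f i := by
    intro ι s f
    induction s using Finset.cons_induction with
    | empty => simp
    | cons a s ha ih => rw [Finset.prod_cons, Finset.sum_cons, zpow_add₀ ht, ih]
  rw [Finset.prod_neg, hprod, hprod, neg_pow] at h
  set n := Fintype.card C
  set a := ∑ c, m (e.symm c).1
  set b := ∑ c, min (m (D.left (S.tail c))) (m (D.left (S.tail c + 1)))
  -- `b` comes from the row factors, `a` from the weights of the regions, and `n` from the factor
  -- `-t` in `overMatrixFlip_eq`; the signs `(-1) ^ n` on the two sides cancel.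
  refine ⟨b - a - n, 1, ?_⟩
  rw [Finset.card_univ] at h
  have hsgn : ((-1 : K) ^ n) ≠ 0 := by simp
  have h4 : t ^ n * (S.overMatrix t⁻¹).det * t ^ a = t ^ b * (S.underMatrix t).det := by
    apply mul_left_cancel₀ (mul_ne_zero hsgn hQ)
    linear_combination h
  rw [zpow_sub₀ ht, zpow_sub₀ ht, zpow_natCast]
  have := zpow_ne_zero a ht
  field_simp
  simp only [Units.val_one, Int.cast_one, one_div]
  linear_combination h4

end Duality

end RegionSystem

/-! ### The arrow system of a Gauss diagram -/

theorem Passage.opp_opp (p : Passage) : p.opp.opp = p := by cases p; simp [Passage.opp]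

theorem Passage.opp_upper (p : Passage) : p.opp.upper = !p.upper := rfl

theorem Passage.opp_sign (p : Passage) : p.opp.sign = p.sign := rfl

theorem Passage.opp_chord (p : Passage) : p.opp.chord = p.chord := rfl

theorem coe_finRotate_of_lt {n : ℕ} (i : Fin n) (hi : i.1 + 1 < n) :
    (finRotate n i).1 = i.1 + 1 := by
  cases n with
  | zero => exact i.elim0
  | succ n => exact coe_finRotate_of_ne_last (by intro h; rw [h] at hi; simp at hi)

theorem List.Nodup.map_get_sublist_iff {α : Type*} {w : List α} (hw : w.Nodup)
    (is : List (Fin w.length)) : (is.map w.get).Sublist w ↔ is.Pairwise (· < ·) := by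
  constructor
  · intro h
    obtain ⟨js, hjs, hp⟩ := List.sublist_eq_map_getElem h
    have : is = js := by
      apply List.map_injective_iff.2 hw.injective_get
      exact hjs
    rwa [this]
  · intro h
    exact List.map_getElem_sublist h

namespace GaussDiagram

variable (G : GaussDiagram)

/-- The position of the other passage through the same double point. -/
def mate (i : Fin G.word.length) : Fin G.word.length :=
  ⟨G.word.idxOf (G.word.get i).opp, List.idxOf_lt_length_of_mem (G.opp_mem _ (List.get_mem _ i))⟩

theorem get_mate (i : Fin G.word.length) : G.word.get (G.mate i) = (G.word.get i).opp := by
  simp [mate]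

theorem get_injective : Function.Injective G.word.get := G.nodup.injective_get

theorem get_eq_opp_iff {i j : Fin G.word.length} :
    G.word.get j = (G.word.get i).opp ↔ j = G.mate i := by
  rw [← G.get_mate, G.get_injective.eq_iff]

theorem mate_mate (i : Fin G.word.length) : G.mate (G.mate i) = i := by
  rw [eq_comm, ← G.get_eq_opp_iff, G.get_mate, Passage.opp_opp]

theorem mate_injective : Function.Injective G.mate :=
  Function.LeftInverse.injective G.mate_mate

/-- The arrows of a Gauss diagram, given by the positions of their heads. -/
abbrev Arrow : Type := {i : Fin G.word.length // (G.word.get i).upper = false}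

/-- The arrow system of a Gauss diagram. -/
def arrowSystem : ArrowSystem G.Arrow G.word.length where
  tail c := G.mate c.1
  head c := c.1
  sign c := (G.word.get c.1).sign
  tail_injective c d h := Subtype.ext (G.mate_injective (Fin.ext h))
  head_injective c d h := Subtype.ext (Fin.ext h)
  tail_ne_head c d h := by
    have h' := congrArg Passage.upper (G.get_mate c.1)
    rw [Fin.ext h, Passage.opp_upper, c.2, d.2] at h'
    simp at h'
  tail_lt c := (G.mate c.1).2
  head_lt c := c.1.2
  covers i hi := by
    by_cases h : (G.word.get ⟨i, hi⟩).upper = false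
    · exact Or.inr ⟨⟨⟨i, hi⟩, h⟩, rfl⟩
    · refine Or.inl ⟨⟨G.mate ⟨i, hi⟩, ?_⟩, ?_⟩
      · rw [G.get_mate, Passage.opp_upper]
        simpa using h
      · rw [G.mate_mate]

theorem toFinset_word : G.word.toFinset = Finset.univ.map ⟨G.word.get, G.get_injective⟩ := by
  ext p
  simp only [List.mem_toFinset, Finset.mem_map, Finset.mem_univ, true_and,
    Function.Embedding.coeFn_mk, List.mem_iff_get]

theorem pairing_eq : G.pairing = G.arrowSystem.pairing := by
  let f : Fin G.word.length → Fin G.word.length → ℤ := fun i j =>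
    if i < G.mate j ∧ G.mate j < G.mate i ∧ G.mate i < j then
      ((G.word.get i).sign * (G.word.get j).sign : ℤ) else 0
  have h1 : G.pairing = ∑ i, ∑ j, if (G.word.get i).upper = false ∧ (G.word.get j).upper = false
      then f i j else 0 := by
    rw [pairing, toFinset_word, Finset.sum_map]
    refine Finset.sum_congr rfl fun i _ => ?_
    rw [Finset.sum_map]
    -- The sum over tails is reindexed by their heads, as an arrow is represented by the position of
    -- its head.
    refine Finset.sum_equiv ⟨G.mate, G.mate, G.mate_mate, G.mate_mate⟩ (by simp) fun j _ => ?_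
    simp only [Function.Embedding.coeFn_mk, Equiv.coe_fn_mk, ← G.get_mate]
    have : [G.word.get i, G.word.get j, G.word.get (G.mate i), G.word.get (G.mate j)] =
      [i, j, G.mate i, G.mate j].map G.word.get := rfl
    have hs : [G.word.get i, G.word.get j, G.word.get (G.mate i), G.word.get (G.mate j)].Sublist
        G.word ↔ i < j ∧ j < G.mate i ∧ G.mate i < G.mate j := by
      rw [this, G.nodup.map_get_sublist_iff]
      simp only [List.pairwise_cons, List.mem_cons, List.not_mem_nil, or_false, forall_eq_or_imp,
        forall_eq, List.Pairwise.nil, and_true, IsEmpty.forall_iff, implies_true]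
      omega
    simp only [f, G.mate_mate]
    rw [← ite_and]
    have hu : (G.word.get (G.mate j)).upper = false ↔ (G.word.get j).upper = true := by
      rw [G.get_mate j, Passage.opp_upper, Bool.not_eq_false']
    have hsign : (G.word.get (G.mate j)).sign = (G.word.get j).sign := by
      rw [G.get_mate j, Passage.opp_sign]
    rw [hsign]
    refine if_congr ?_ rfl rfl
    rw [hs, hu]
    tauto
  have h2 : ∀ i, ∑ j, (if (G.word.get i).upper = false ∧ (G.word.get j).upper = false
      then f i j else 0) =
      if (G.word.get i).upper = false then ∑ d : G.Arrow, f i d.1 else 0 := by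
    intro i
    by_cases h : (G.word.get i).upper = false
    · simp only [h, true_and, if_true]
      rw [← Finset.sum_filter]
      exact Finset.sum_subtype _ (by simp) _
    · rw [if_neg h]
      exact Finset.sum_eq_zero fun j _ => if_neg fun h' => h h'.1
  rw [h1, Finset.sum_congr rfl fun i _ => h2 i, ← Finset.sum_filter]
  exact Finset.sum_subtype _ (by simp) _

/-! ### The Alexander polynomial as the determinant of the over-matrix -/

/-- Change of variables from edge values to jumps: with the value on the base edge set to zero, an
edge value is the sum of the preceding jumps. The transition matrix is unitriangular. The last
column of `M` is a unit vector, so the last row and column can be dropped. -/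
theorem _root_.Matrix.det_minor_eq {R : Type*} [CommRing R] {n : ℕ}
    (A M : Matrix (Fin n) (Fin n) R)
    (h : ∀ i k : Fin n, i.1 + 1 < n → ∑ j, (if k < j then A i j else 0) = M i k)
    (hM : ∀ i k : Fin n, k.1 + 1 = n → M i k = if i = k then 1 else 0) :
    Matrix.det (A.submatrix (fun i : Fin (n - 1) => (⟨i.1, by omega⟩ : Fin n))
      (fun j : Fin (n - 1) => (⟨j.1 + 1, by omega⟩ : Fin n))) = M.det := by
  cases n with
  | zero => simp
  | succ m =>
    have e1 : M.det = (M.submatrix Fin.castSucc Fin.castSucc).det := by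
      rw [Matrix.det_succ_column M (Fin.last m), Finset.sum_eq_single (Fin.last m)]
      · rw [hM _ _ (by simp)]
        simp [Fin.succAbove_last, ← two_mul, pow_mul]
      · intro i _ hi
        rw [hM _ _ (by simp), if_neg hi]
        simp
      · simp
    let U : Matrix (Fin m) (Fin m) R := fun j k => if k ≤ j then 1 else 0
    have hU : U.det = 1 := by
      rw [Matrix.det_of_isLowerTriangular]
      · simp [U]
      · intro i j hij
        simp only [U]
        rw [if_neg]
        simpa using hij
    rw [e1, ← mul_one (Matrix.det _), ← hU]
    change (A.submatrix Fin.castSucc Fin.succ).det * U.det = _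
    rw [← Matrix.det_mul]
    congr 1
    ext i k
    rw [Matrix.mul_apply, Matrix.submatrix_apply, ← h _ _ (by simp), Fin.sum_univ_succ]
    simp only [Matrix.submatrix_apply, U, mul_ite, mul_one, mul_zero]
    rw [if_neg (by simp), zero_add]
    refine Finset.sum_congr rfl fun j _ => ?_
    refine if_congr ?_ rfl rfl
    exact ⟨fun h => Nat.lt_succ_of_le h, fun h => Nat.le_of_lt_succ h⟩

/-- The coefficients of the jumps in the Alexander relations. -/
noncomputable def jumpMatrix : Matrix (Fin G.word.length) (Fin G.word.length) ℤ[T;T⁻¹] :=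
  fun i k => (if i = k then 1 else 0) - if (G.word.get i).upper then 0 else
    (LaurentPolynomial.T ((G.word.get i).sign : ℤ) - 1) *
      ((if k < i then 1 else 0) - if k < G.mate i then 1 else 0)

theorem alexanderPolynomial_eq_det_jumpMatrix : G.alexanderPolynomial = G.jumpMatrix.det := by
  refine Matrix.det_minor_eq _ _ (fun i k hi => ?_) (fun i k hk => ?_)
  · have h1 : ∀ (j₀ : Fin G.word.length) (a : ℤ[T;T⁻¹]),
        ∑ j, (if k < j then (if j = j₀ then a else 0) else 0) = if k < j₀ then a else 0 := by
      intro j₀ a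
      rw [Finset.sum_eq_single j₀] <;> simp +contextual
    have h2 : ∀ j, (if k < j then G.alexanderMatrix i j else 0) =
        (if k < j then (if j = finRotate _ i then 1 else 0) else 0) -
        if (G.word.get i).upper then (if k < j then (if j = i then 1 else 0) else 0) else
          (if k < j then (if j = i then LaurentPolynomial.T ((G.word.get i).sign : ℤ) else 0)
            else 0) +
          (if k < j then (if j = G.mate i then 1 - LaurentPolynomial.T ((G.word.get i).sign : ℤ)
            else 0) else 0) := by
      intro j
      rw [alexanderMatrix]
      simp only [G.get_eq_opp_iff]
      split_ifs <;> ring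
    have h3 : k < finRotate _ i ↔ k ≤ i := by
      rw [Fin.lt_def, coe_finRotate_of_lt i hi, Fin.le_def]
      omega
    rw [Finset.sum_congr rfl fun j _ => h2 j, Finset.sum_sub_distrib, h1, jumpMatrix]
    have h4 : (if k < finRotate _ i then (1 : ℤ[T;T⁻¹]) else 0) =
        (if i = k then 1 else 0) + if k < i then 1 else 0 := by
      simp only [h3, le_iff_lt_or_eq, eq_comm (a := i)]
      by_cases e : k = i
      · subst e; simp
      · simp [e]
    rw [h4]
    by_cases hu : (G.word.get i).upper
    · simp only [hu, if_true, h1]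
      ring
    · simp only [hu, if_false, Finset.sum_add_distrib, h1, Bool.false_eq_true]
      split_ifs <;> ring
  · rw [jumpMatrix]
    have h1 : ¬ k < i := by rw [Fin.lt_def]; omega
    have h2 : ¬ k < G.mate i := by rw [Fin.lt_def]; omega
    simp [h1, h2]

/-- Rows at upper passages say that the jump there is zero, which gives an identity block. Rows at
lower passages are those of the over-matrix up to the factor `1` or `-t⁻¹`. Only diagonal entries of
the over-matrix depend on a sign, since the other loops do not jump at the head; so the sign
attached to the column can be read from the row. -/
theorem det_jumpMatrix_eq :
    G.jumpMatrix.det = (∏ c, (if G.arrowSystem.sign c = 1 then 1 else -LaurentPolynomial.T (-1))) *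
      (G.arrowSystem.overMatrix (LaurentPolynomial.T 1 : ℤ[T;T⁻¹])).det := by
  rw [Matrix.twoBlockTriangular_det _ fun i => (G.word.get i).upper = false]
  · have h1 : (G.jumpMatrix.toSquareBlockProp fun i => ¬ (G.word.get i).upper = false) = 1 := by
      refine Matrix.ext fun i j => ?_
      have := i.2
      simp only [Bool.not_eq_false] at this
      simp only [Matrix.toSquareBlockProp_def, Matrix.of_apply, jumpMatrix, this, if_true, sub_zero,
        Matrix.one_apply, Subtype.ext_iff]
    rw [h1, Matrix.det_one, mul_one, ← Matrix.det_diagonal, ← Matrix.det_mul]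
    congr 1
    refine Matrix.ext fun c d => ?_
    rw [Matrix.diagonal_mul]
    simp only [Matrix.toSquareBlockProp_def, Matrix.of_apply, jumpMatrix, c.2, ArrowSystem.overMatrix]
    have h2 := G.arrowSystem.loop_head_succ c d
    have h3 : G.arrowSystem.loop c (G.arrowSystem.head d + 1) =
        (if d.1 < c.1 then 1 else 0) - if d.1 < G.mate c.1 then 1 else 0 := by
      simp only [ArrowSystem.loop, arrowSystem, Fin.lt_def]
      split_ifs <;> omega
    have h4 : G.arrowSystem.loop c (G.arrowSystem.head d) =
        (if d.1 < c.1 then 1 else 0) - (if d.1 < G.mate c.1 then 1 else 0) +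
          if c = d then 1 else 0 := by
      rw [← h3, h2]; ring
    rw [h3, h4]
    have h5 : (LaurentPolynomial.T (-1) : ℤ[T;T⁻¹]) * LaurentPolynomial.T 1 = 1 := by
      rw [← LaurentPolynomial.T_add]; simp
    have h6 : G.arrowSystem.sign c = (G.word.get c.1).sign := rfl
    have h7 : (if c.1 = d.1 then (1 : ℤ[T;T⁻¹]) else 0) = if c = d then 1 else 0 :=
      if_congr Subtype.ext_iff.symm rfl rfl
    rw [← h6, h7]
    push_cast
    generalize hx : ((if d.1 < c.1 then 1 else 0) - if d.1 < G.mate c.1 then 1 else 0 :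
      ℤ[T;T⁻¹]) = x
    by_cases e : c = d
    · subst e
      rcases Int.units_eq_one_or (G.arrowSystem.sign c) with h | h
      · simp [h]; ring
      · simp [h]; linear_combination (-x - 1) * h5
    · rcases Int.units_eq_one_or (G.arrowSystem.sign c) with h | h
      · simp [h, e]; ring
      · simp [h, e]; linear_combination x * h5
  · intro i hi j hj
    simp only [Bool.not_eq_false] at hi
    rw [jumpMatrix, hi, if_pos rfl, sub_zero, if_neg]
    rintro rfl
    rw [hi] at hj
    simp at hj

/-- The Alexander polynomial is, up to a unit, the determinant of the over-matrix. -/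
theorem exists_alexanderPolynomial_eq : ∃ u : (ℤ[T;T⁻¹])ˣ, G.alexanderPolynomial =
    u * (G.arrowSystem.overMatrix (LaurentPolynomial.T 1 : ℤ[T;T⁻¹])).det := by
  have h : IsUnit (∏ c, (if G.arrowSystem.sign c = 1 then 1 else
      -LaurentPolynomial.T (-1) : ℤ[T;T⁻¹])) := by
    rw [IsUnit.prod_iff]
    intro c _
    split_ifs
    · exact isUnit_one
    · exact (LaurentPolynomial.isUnit_T _).neg
  exact ⟨h.unit, by
    rw [alexanderPolynomial_eq_det_jumpMatrix, det_jumpMatrix_eq, IsUnit.unit_spec]⟩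

end GaussDiagram

/-! ### The regions of a planar Gauss diagram -/

theorem List.Nodup.formPerm_get {α : Type*} [DecidableEq α] {w : List α} (hw : w.Nodup)
    (i : Fin w.length) :
    w.formPerm (w.get i) = w.get ⟨(i.1 + 1) % w.length, Nat.mod_lt _ i.pos⟩ := by
  simpa using List.formPerm_apply_getElem w hw i.1 i.2

theorem List.Nodup.formPerm_symm_get {α : Type*} [DecidableEq α] {w : List α} (hw : w.Nodup)
    (i : Fin w.length) :
    w.formPerm.symm (w.get i) =
      w.get ⟨(i.1 + (w.length - 1)) % w.length, Nat.mod_lt _ i.pos⟩ := by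
  rw [Equiv.symm_apply_eq, hw.formPerm_get]
  congr 1
  apply Fin.ext
  have := i.2
  simp only [Nat.mod_add_mod]
  rw [show i.1 + (w.length - 1) + 1 = i.1 + w.length by omega, Nat.add_mod_right,
    Nat.mod_eq_of_lt i.2]

namespace GaussDiagram

variable (G : GaussDiagram)

/-- The region on the left of the edge arriving at the position `i` in the direction `d`. -/
def dart (i : Fin G.word.length) (d : ℤˣ) : G.Face :=
  Quot.mk _ (⟨G.word.get i, List.get_mem _ i⟩, d)

variable {G} (h0 : 0 < G.word.length)

/-- The region on the left of the edge `e`. -/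
def leftFace (e : ℕ) : G.Face := G.dart ⟨e % G.word.length, Nat.mod_lt _ h0⟩ 1

/-- The region on the right of the edge `e`. -/
def rightFace (e : ℕ) : G.Face :=
  -- Followed against the orientation, edge `e` arrives at position `e - 1`, and its right side is
  -- then on the left.
  G.dart ⟨(e + (G.word.length - 1)) % G.word.length, Nat.mod_lt _ h0⟩ (-1)

theorem leftFace_eq (i : Fin G.word.length) : leftFace h0 i.1 = G.dart i 1 := by
  unfold leftFace
  congr 1
  exact Fin.ext (Nat.mod_eq_of_lt i.2)

theorem rightFace_succ (i : Fin G.word.length) : rightFace h0 (i.1 + 1) = G.dart i (-1) := by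
  unfold rightFace
  congr 1
  apply Fin.ext
  simp only
  rw [show i.1 + 1 + (G.word.length - 1) = i.1 + G.word.length by omega, Nat.add_mod_right,
    Nat.mod_eq_of_lt i.2]

theorem dart_eq (i : Fin G.word.length) (d : ℤˣ) : G.dart i d =
    if d * (G.word.get i).sign * (if (G.word.get i).upper then 1 else -1) = 1 then
      leftFace h0 ((G.mate i).1 + 1) else rightFace h0 (G.mate i).1 := by
  by_cases h : d * (G.word.get i).sign * (if (G.word.get i).upper then 1 else -1) = 1
  · rw [if_pos h]
    apply Quot.sound
    simp only [turnLeft, h, if_true, ← G.get_mate, G.nodup.formPerm_get]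
  · rw [if_neg h]
    apply Quot.sound
    have h' := (Int.units_eq_one_or _).resolve_left h
    simp only [turnLeft, h', ← G.get_mate, G.nodup.formPerm_symm_get]
    rfl

/-- The regions of a Gauss diagram with at least one arrow. -/
def regionSystem : RegionSystem G.arrowSystem G.Face where
  left := leftFace h0
  right := rightFace h0
  left_len := by simp [leftFace]
  right_len := by simp [rightFace]
  positive c hc := by
    have hc' : (G.word.get c.1).sign = 1 := hc
    have hm : (G.word.get (G.mate c.1)).sign = 1 := by rw [G.get_mate, Passage.opp_sign, hc']
    have hu : (G.word.get (G.mate c.1)).upper = true := by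
      rw [G.get_mate, Passage.opp_upper, c.2]; rfl
    simp only [arrowSystem]
    rw [leftFace_eq, leftFace_eq, rightFace_succ, rightFace_succ]
    refine ⟨?_, ?_, ?_, ?_⟩
    · rw [dart_eq h0, hm, hu, G.mate_mate, if_pos (by decide)]
    · rw [dart_eq h0, hm, hu, G.mate_mate, if_neg (by decide)]
    · rw [dart_eq h0, hc', c.2, if_neg (by decide)]
    · rw [dart_eq h0, hc', c.2, if_pos (by decide)]
  negative c hc := by
    have hc' : (G.word.get c.1).sign = -1 := hc
    have hm : (G.word.get (G.mate c.1)).sign = -1 := by rw [G.get_mate, Passage.opp_sign, hc']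
    have hu : (G.word.get (G.mate c.1)).upper = true := by
      rw [G.get_mate, Passage.opp_upper, c.2]; rfl
    simp only [arrowSystem]
    rw [leftFace_eq, leftFace_eq, rightFace_succ, rightFace_succ]
    refine ⟨?_, ?_, ?_, ?_⟩
    · rw [dart_eq h0, hm, hu, G.mate_mate, if_neg (by decide)]
    · rw [dart_eq h0, hm, hu, G.mate_mate, if_pos (by decide)]
    · rw [dart_eq h0, hc', c.2, if_pos (by decide)]
    · rw [dart_eq h0, hc', c.2, if_neg (by decide)]
  covers f := by
    induction f using Quot.ind with
    | mk x =>
      obtain ⟨⟨p, hp⟩, d⟩ := x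
      obtain ⟨i, rfl⟩ := List.mem_iff_get.1 hp
      rcases Int.units_eq_one_or d with rfl | rfl
      · exact ⟨i.1, i.2.le, Or.inl (leftFace_eq h0 i).symm⟩
      · exact ⟨i.1 + 1, i.2, Or.inr (rightFace_succ h0 i).symm⟩

theorem length_eq : G.word.length = 2 * Fintype.card G.Arrow := by
  have := G.arrowSystem.sum_range fun _ => 1
  simpa [mul_comm] using this

variable (G) in
/-- A planar diagram has an Alexander numbering, and inverting the variable of its over-matrix gives
the determinant of its under-matrix up to a unit. -/
theorem IsPlanar.exists_numbering (hG : G.IsPlanar) :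
    (∃ ν, G.arrowSystem.IsNumbering ν) ∧ ∀ {K : Type} [Field K] {t : K}, t ≠ 0 →
      ∃ (k : ℤ) (σ : ℤˣ), (G.arrowSystem.overMatrix t⁻¹).det =
        ((σ : ℤ) : K) * t ^ k * (G.arrowSystem.underMatrix t).det := by
  rcases hG with h | h
  · have : IsEmpty G.Arrow := ⟨fun c => by
      have := c.1.2
      simp [h] at this⟩
    exact ⟨⟨fun _ => 0, isEmptyElim, isEmptyElim, isEmptyElim, rfl⟩,
      fun _ => ⟨0, 1, by simp [Matrix.det_isEmpty]⟩⟩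
  · by_cases h0 : 0 < G.word.length
    · have hl := G.length_eq
      -- An infinite type has `Nat.card` zero, which the Euler characteristic excludes.
      have : Finite G.Face := Nat.finite_of_card_ne_zero (by omega)
      have := Fintype.ofFinite G.Face
      have hF : Fintype.card G.Face = Fintype.card G.Arrow + 2 := by
        rw [← Nat.card_eq_fintype_card]
        omega
      obtain ⟨m, hm⟩ := (regionSystem h0).exists_numbering hF
      exact ⟨⟨_, hm.isNumbering⟩, fun ht => (regionSystem h0).det_overMatrix_inv hF hm ht⟩
    · exfalso
      have hw : G.word.length = 0 := by omega
      have : IsEmpty G.Face := ⟨fun f => by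
        induction f using Quot.ind with
        | mk x =>
          have := List.length_pos_of_mem x.1.2
          omega⟩
      rw [Nat.card_of_isEmpty] at h
      omega

end GaussDiagram

/-! ### Laurent polynomials -/

namespace LaurentPolynomial

theorem eval₂_comp_invert {R : Type*} [CommRing R] (u : Rˣ) (f : ℤ[T;T⁻¹]) :
    eval₂ (Int.castRingHom R) u (invert f) = eval₂ (Int.castRingHom R) u⁻¹ f := by
  induction f using LaurentPolynomial.induction_on' with
  | add p q hp hq => simp only [map_add, hp, hq]
  | C_mul_T n a => simp [map_mul]

/-- Modulo 2 the points `1` and `-1` coincide. This forces the symmetry exponent in `exists_conway`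
to be even. -/
theorem two_dvd_eval₂_sub (f : ℤ[T;T⁻¹]) :
    2 ∣ eval₂ (Int.castRingHom ℤ) 1 f - eval₂ (Int.castRingHom ℤ) (-1) f := by
  induction f using LaurentPolynomial.induction_on' with
  | add p q hp hq => simp only [map_add]; omega
  | C_mul_T n a =>
    simp only [map_mul, eval₂_C, eval₂_T, one_zpow]
    rcases Int.even_or_odd n with h | h
    · simp [h.neg_one_zpow]
    · simp only [h.neg_one_zpow]
      exact ⟨a, by rw [eq_intCast, Int.cast_id]; push_cast; ring⟩

/-- A symmetric Laurent polynomial is the sum of a constant and a Laurent polynomial and its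
inverse. -/
theorem exists_eq_add_invert {g : ℤ[T;T⁻¹]} (hg : invert g = g) :
    ∃ (h : ℤ[T;T⁻¹]) (a : ℤ), g = h + C a + invert h := by
  refine ⟨.ofCoeff (g.coeff.filter (0 < ·)), g.coeff 0, ?_⟩
  ext n
  have hs : g.coeff (-n) = g.coeff n := by rw [← invert_apply, hg]
  have hC : (C (g.coeff 0) : ℤ[T;T⁻¹]).coeff n = if n = 0 then g.coeff 0 else 0 :=
    C_apply _ _
  simp only [AddMonoidAlgebra.coeff_add, Finsupp.add_apply, invert_apply, hC, Finsupp.filter_apply]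
  rcases lt_trichotomy n 0 with h | rfl | h
  · simp [h, h.ne, h.le, hs]
  · simp
  · simp [h, h.ne', h.le]

/-- The substitution `t = s ^ 2`. -/
noncomputable abbrev square : ℤ[T;T⁻¹] →+* ℤ[T;T⁻¹] :=
  eval₂ (C : ℤ →+* ℤ[T;T⁻¹]) (isUnit_T 2).unit

theorem val_unit_T_zpow (m n : ℤ) :
    (((isUnit_T m).unit ^ n : (ℤ[T;T⁻¹])ˣ) : ℤ[T;T⁻¹]) = T (m * n) := by
  have h : ∀ k : ℕ, (((isUnit_T m).unit ^ (k : ℤ) : (ℤ[T;T⁻¹])ˣ) : ℤ[T;T⁻¹]) = T (m * k) := by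
    intro k
    rw [zpow_natCast, Units.val_pow_eq_pow_val, IsUnit.unit_spec, T_pow, mul_comm]
  obtain ⟨k, rfl | rfl⟩ := n.eq_nat_or_neg
  · exact h k
  · rw [zpow_neg, ← Units.mul_right_inj ((isUnit_T m).unit ^ (k : ℤ)), Units.mul_inv, h,
      ← T_add]
    simp

theorem square_T (n : ℤ) : square (T n) = T (2 * n) := by
  rw [square, eval₂_T, val_unit_T_zpow]

theorem square_C (a : ℤ) : square (C a) = C a := eval₂_C _ _ _

theorem eval₂_square {R : Type*} [CommRing R] (u : Rˣ) (f : ℤ[T;T⁻¹]) :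
    eval₂ (Int.castRingHom R) u (square f) = eval₂ (Int.castRingHom R) (u ^ 2) f := by
  induction f using LaurentPolynomial.induction_on' with
  | add p q hp hq => simp only [map_add, hp, hq]
  | C_mul_T n a =>
    rw [map_mul, map_mul, map_mul, square_C, square_T, eval₂_C, eval₂_C, eval₂_T, eval₂_T, zpow_mul]
    rfl

/-- A Chebyshev-type recursion, starting from `2` and `s² + s⁻² = (s - s⁻¹)² + 2`. -/
theorem T_add_T_neg_mem (n : ℤ) : (T (2 * n) + T (-(2 * n)) : ℤ[T;T⁻¹]) ∈
    (Polynomial.aeval (T 1 - T (-1) : ℤ[T;T⁻¹]) : Polynomial ℤ →ₐ[ℤ] ℤ[T;T⁻¹]).range := by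
  set S := (Polynomial.aeval (T 1 - T (-1) : ℤ[T;T⁻¹]) : Polynomial ℤ →ₐ[ℤ] ℤ[T;T⁻¹]).range
  have hz : (T 1 - T (-1) : ℤ[T;T⁻¹]) ∈ S := ⟨Polynomial.X, by simp⟩
  have h2 : (2 : ℤ[T;T⁻¹]) ∈ S := by
    exact_mod_cast S.natCast_mem 2
  have hT : (T 1 : ℤ[T;T⁻¹]) * T (-1) = 1 := by rw [← T_add]; simp
  have hTT : ∀ a b : ℤ, (T (a + b) : ℤ[T;T⁻¹]) = T a * T b := T_add
  have hc : (T 2 + T (-2) : ℤ[T;T⁻¹]) ∈ S := by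
    have : (T 2 + T (-2) : ℤ[T;T⁻¹]) = (T 1 - T (-1)) ^ 2 + 2 := by
      rw [show (2 : ℤ) = 1 + 1 by rfl, neg_add, hTT, hTT]
      linear_combination 2 * hT
    rw [this]
    exact S.add_mem (S.pow_mem hz 2) h2
  have key : ∀ m : ℕ, (T (2 * m) + T (-(2 * m)) : ℤ[T;T⁻¹]) ∈ S ∧
      (T (2 * (m + 1)) + T (-(2 * (m + 1))) : ℤ[T;T⁻¹]) ∈ S := by
    intro m
    induction m with
    | zero =>
      refine ⟨?_, by simpa using hc⟩
      simp only [Nat.cast_zero, mul_zero, neg_zero, T_zero, one_add_one_eq_two]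
      exact h2
    | succ m ih =>
      refine ⟨by exact_mod_cast ih.2, ?_⟩
      have : (T (2 * ((m + 1 : ℕ) + 1)) + T (-(2 * ((m + 1 : ℕ) + 1))) : ℤ[T;T⁻¹]) =
          (T 2 + T (-2)) * (T (2 * (m + 1)) + T (-(2 * (m + 1)))) -
            (T (2 * m) + T (-(2 * m))) := by
        simp only [add_mul, mul_add, ← T_add]
        push_cast
        ring_nf
      rw [this]
      exact S.sub_mem (S.mul_mem hc ih.2) ih.1
  obtain ⟨m, rfl | rfl⟩ := n.eq_nat_or_neg
  · exact (key m).1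
  · rw [mul_neg, neg_neg, add_comm]
    exact (key m).1

theorem square_mem_of_invert_eq {g : ℤ[T;T⁻¹]} (hg : invert g = g) : square g ∈
    (Polynomial.aeval (T 1 - T (-1) : ℤ[T;T⁻¹]) : Polynomial ℤ →ₐ[ℤ] ℤ[T;T⁻¹]).range := by
  set S := (Polynomial.aeval (T 1 - T (-1) : ℤ[T;T⁻¹]) : Polynomial ℤ →ₐ[ℤ] ℤ[T;T⁻¹]).range
  have hC : ∀ a : ℤ, (C a : ℤ[T;T⁻¹]) ∈ S := fun a => ⟨Polynomial.C a, by simp⟩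
  obtain ⟨h, a, rfl⟩ := exists_eq_add_invert hg
  rw [map_add, map_add, square_C, add_right_comm]
  refine S.add_mem ?_ (hC a)
  clear hg
  induction h using LaurentPolynomial.induction_on' with
  | add p q hp hq =>
    simp only [map_add]
    rw [add_add_add_comm]
    exact S.add_mem hp hq
  | C_mul_T n a =>
    rw [map_mul, map_mul, map_mul, invert_C, invert_T, square_C, square_T, square_T, ← mul_add,
      mul_neg]
    exact S.mul_mem (hC a) (T_add_T_neg_mem n)

theorem eval₂_aeval {R : Type*} [CommRing R] (u : Rˣ) (p : Polynomial ℤ) :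
    eval₂ (Int.castRingHom R) u (Polynomial.aeval (T 1 - T (-1) : ℤ[T;T⁻¹]) p) =
      (p.map (Int.castRingHom R)).eval ((u : R) - (u⁻¹ : Rˣ)) := by
  rw [Polynomial.aeval_def, Polynomial.hom_eval₂, Polynomial.eval_map]
  congr 1
  · exact RingHom.ext_int _ _
  · simp

/-- The value at `1` is `±1`, so `σ = 1`. If `k` were odd, the value at `-1` would vanish,
contradicting parity. Hence half of `k` can be absorbed into `f`, which makes it symmetric. -/
theorem exists_conway {f : ℤ[T;T⁻¹]} {k : ℤ} {σ : ℤˣ} (hf : invert f = C (σ : ℤ) * T k * f)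
    {δ : ℤˣ} (hδ : eval₂ (Int.castRingHom ℤ) 1 f = δ) :
    ∃ p : Polynomial ℤ, p.eval 0 = 1 ∧ ∃ u : (ℤ[T;T⁻¹])ˣ,
      Polynomial.aeval (T 1 - T (-1) : ℤ[T;T⁻¹]) p = u * square f := by
  have hσ : σ = 1 := by
    have := congrArg (eval₂ (Int.castRingHom ℤ) 1) hf
    rw [eval₂_comp_invert, map_mul, map_mul, eval₂_C, eval₂_T, inv_one, hδ] at this
    simp only [one_zpow, Units.val_one, mul_one, eq_intCast, Int.cast_id] at this
    have h' : δ = σ * δ := Units.ext (by simpa using this)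
    simpa using h'.symm
  subst hσ
  have hk : Even k := by
    by_contra hk
    rw [Int.not_even_iff_odd] at hk
    have h1 := congrArg (eval₂ (Int.castRingHom ℤ) (-1)) hf
    rw [eval₂_comp_invert, map_mul, map_mul, eval₂_C, eval₂_T, hk.neg_one_zpow] at h1
    have h2 : ((-1 : ℤˣ))⁻¹ = -1 := by decide
    rw [h2] at h1
    simp only [Units.val_one, map_one, one_mul, Units.val_neg] at h1
    have h3 := two_dvd_eval₂_sub f
    rw [hδ] at h3
    rcases Int.units_eq_one_or δ with rfl | rfl <;>
      simp only [Units.val_one, Units.val_neg] at h3 <;> omega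
  obtain ⟨j, rfl⟩ := hk
  have hg : invert (C (δ : ℤ) * T j * f) = C (δ : ℤ) * T j * f := by
    rw [map_mul, map_mul, invert_C, invert_T, hf, T_add]
    have : (T (-j) : ℤ[T;T⁻¹]) * T j = 1 := by rw [← T_add]; simp
    simp only [Units.val_one, map_one]
    linear_combination (C (δ : ℤ) * T j * f) * this
  obtain ⟨p, hp⟩ := square_mem_of_invert_eq hg
  have hp' : Polynomial.aeval (T 1 - T (-1) : ℤ[T;T⁻¹]) p = square (C (δ : ℤ) * T j * f) := hp
  refine ⟨p, ?_, ?_⟩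
  · have h := congrArg (eval₂ (Int.castRingHom ℤ) 1) hp'
    rw [eval₂_aeval, eval₂_square, map_mul, map_mul, eval₂_C, eval₂_T, one_pow, hδ] at h
    rcases Int.units_eq_one_or δ with rfl | rfl <;> simpa using h
  · have hu : IsUnit (square (C (δ : ℤ) * T j)) :=
      (((Units.isUnit δ).map (C : ℤ →+* ℤ[T;T⁻¹])).mul (isUnit_T j)).map square
    exact ⟨hu.unit, by rw [hp', map_mul, IsUnit.unit_spec]⟩

/-- Clearing denominators in `w * v = 1` gives a factorization of a power of the prime `X`. -/
theorem exists_eq_of_isUnit {w : ℤ[T;T⁻¹]} (hw : IsUnit w) :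
    ∃ (σ : ℤˣ) (k : ℤ), w = C (σ : ℤ) * T k := by
  obtain ⟨v, hv⟩ := hw.exists_right_inv
  obtain ⟨m, P, hP⟩ := exists_T_pow w
  obtain ⟨n, Q, hQ⟩ := exists_T_pow v
  have h : P * Q = Polynomial.X ^ (m + n) := by
    apply Polynomial.toLaurent_injective
    rw [map_mul, hP, hQ, Polynomial.toLaurent_X_pow]
    push_cast
    rw [T_add]
    linear_combination (T m * T n) * hv
  obtain ⟨i, -, hi⟩ := (dvd_prime_pow Polynomial.prime_X _).1 (Dvd.intro Q h)
  obtain ⟨a, ha⟩ := hi.symm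
  obtain ⟨r, hr, hr'⟩ := Polynomial.isUnit_iff.1 a.isUnit
  refine ⟨hr.unit, i - m, ?_⟩
  rw [← hr'] at ha
  rw [T_sub, IsUnit.unit_spec]
  have h' := congrArg Polynomial.toLaurent ha
  rw [map_mul, hP, Polynomial.toLaurent_X_pow, Polynomial.toLaurent_C] at h'
  have h1 : (T m : ℤ[T;T⁻¹]) * T (-m) = 1 := by rw [← T_add]; simp
  linear_combination (-T (-m)) * h' - w * h1

end LaurentPolynomial

/-! ### The second coefficient of the Conway polynomial -/

namespace ArrowSystem

variable {C : Type*} [Fintype C] [DecidableEq C] {len : ℕ} (S : ArrowSystem C len)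

theorem map_det_underMatrix {R : Type*} [CommRing R] (u : Rˣ) :
    LaurentPolynomial.eval₂ (Int.castRingHom R) u
      (S.underMatrix (LaurentPolynomial.T 1 : ℤ[T;T⁻¹])).det = (S.underMatrix (u : R)).det := by
  rw [RingHom.map_det, RingHom.mapMatrix_apply, map_underMatrix, LaurentPolynomial.eval₂_T,
    zpow_one]

/-- The sign matrices cancel, and both the sum and the product of `1 - s²` and `1 - s⁻²` equal `-(s
- s⁻¹)²`. -/
theorem det_underMatrix_mul_det_underMatrix_inv {s : ℝ} (hs : s ≠ 0) :
    (S.underMatrix (s ^ 2)).det * (S.underMatrix (s⁻¹ ^ 2)).det =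
      (1 + (s - s⁻¹) ^ 2 • (-(S.underForm + S.underForm * S.underForm)).map
        (Int.cast : ℤ → ℝ)).det := by
  rw [underMatrix_eq, underMatrix_eq, Matrix.det_mul, Matrix.det_mul]
  have h1 : (S.signMatrix ℝ).det * (S.signMatrix ℝ).det = 1 := by
    rw [← Matrix.det_mul, signMatrix_mul_self, Matrix.det_one]
  rw [mul_mul_mul_comm, h1, one_mul, ← Matrix.det_mul]
  congr 1
  have h2 : (-(S.underForm + S.underForm * S.underForm)).map (Int.cast : ℤ → ℝ) =
      -(S.underForm.map (Int.cast : ℤ → ℝ) +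
        S.underForm.map (Int.cast : ℤ → ℝ) * S.underForm.map (Int.cast : ℤ → ℝ)) := by
    have := (Int.castRingHom ℝ).mapMatrix.map_mul S.underForm S.underForm
    simp only [RingHom.mapMatrix_apply, Int.coe_castRingHom] at this
    rw [← this]
    ext i j
    simp
  rw [h2]
  set N := S.underForm.map (Int.cast : ℤ → ℝ)
  simp only [add_mul, mul_add, one_mul, mul_one, smul_mul_smul_comm, smul_neg, smul_add]
  have e1 : (1 - s ^ 2) * (1 - s⁻¹ ^ 2) = -(s - s⁻¹) ^ 2 := by field_simp; ring
  have e2 : (1 - s ^ 2) + (1 - s⁻¹ ^ 2) = -(s - s⁻¹) ^ 2 := by field_simp; ring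
  rw [e1, neg_smul]
  have e3 : (1 - s ^ 2) • N + (1 - s⁻¹ ^ 2) • N = -((s - s⁻¹) ^ 2 • N) := by
    rw [← add_smul, e2, neg_smul]
  calc _ = 1 + ((1 - s ^ 2) • N + (1 - s⁻¹ ^ 2) • N) + -((s - s⁻¹) ^ 2 • (N * N)) := by abel
    _ = _ := by rw [e3]; abel

/-- The second coefficient of a polynomial in `s - s⁻¹` which is, up to a unit, the determinant of
the under-matrix at `s ^ 2`. -/
theorem coeff_two_eq_pairing {p : Polynomial ℤ} (hp : p.eval 0 = 1) {w : ℤ[T;T⁻¹]}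
    (hw : IsUnit w)
    (h : Polynomial.aeval (LaurentPolynomial.T 1 - LaurentPolynomial.T (-1) : ℤ[T;T⁻¹]) p =
      w * LaurentPolynomial.square
        (S.underMatrix (LaurentPolynomial.T 1 : ℤ[T;T⁻¹])).det) :
    p.coeff 2 = S.pairing := by
  obtain ⟨σ, k, rfl⟩ := LaurentPolynomial.exists_eq_of_isUnit hw
  set P : Polynomial ℝ := p.map (Int.castRingHom ℝ) with hP
  have hP0 : P.eval 0 = 1 := by
    rw [hP]
    simp [hp]
  have hev : ∀ s : ℝ, s ≠ 0 → P.eval (s - s⁻¹) =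
      ((σ : ℤ) : ℝ) * s ^ k * (S.underMatrix (s ^ 2)).det := by
    intro s hs
    have := congrArg (LaurentPolynomial.eval₂ (Int.castRingHom ℝ) (Units.mk0 s hs)) h
    rw [LaurentPolynomial.eval₂_aeval, map_mul, map_mul, LaurentPolynomial.eval₂_square,
      map_det_underMatrix, LaurentPolynomial.eval₂_C, LaurentPolynomial.eval₂_T] at this
    simpa using this
  have hσ : ((σ : ℤ) : ℝ) * ((σ : ℤ) : ℝ) = 1 := by
    rcases Int.units_eq_one_or σ with rfl | rfl <;> simp
  -- Replacing `s` by `-s` leaves `s²` unchanged; at `s = 1` the argument is zero, so the factor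
  -- `(-1) ^ k` is `1` and `P` is even.
  have hneg : ∀ s : ℝ, s ≠ 0 → P.eval (-(s - s⁻¹)) = (-1) ^ k * P.eval (s - s⁻¹) := by
    intro s hs
    have h1 := hev (-s) (neg_ne_zero.2 hs)
    rw [inv_neg, neg_sq, neg_eq_neg_one_mul, mul_zpow] at h1
    rw [hev s hs, show -(s - s⁻¹) = -1 * s - -s⁻¹ by ring, h1]
    ring
  have hk : (-1 : ℝ) ^ k = 1 := by
    have := hneg 1 one_ne_zero
    simp only [inv_one, sub_self, neg_zero, hP0, mul_one] at this
    exact this.symm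
  -- `s` is the positive root of `s² - y s - 1`, so identities in `s - s⁻¹` are identities of
  -- polynomials.
  have hsurj : ∀ y : ℝ, ∃ s : ℝ, s ≠ 0 ∧ s - s⁻¹ = y := by
    intro y
    have h4 : 0 ≤ y ^ 2 + 4 := by positivity
    have h5 : |y| < √(y ^ 2 + 4) := Real.lt_sqrt_of_sq_lt (by rw [sq_abs]; linarith)
    have h6 : 0 < (y + √(y ^ 2 + 4)) / 2 := by
      have := neg_abs_le y
      linarith
    refine ⟨_, h6.ne', ?_⟩
    have h7 := Real.sq_sqrt h4
    set s := (y + √(y ^ 2 + 4)) / 2 with hs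
    have h8 : s ^ 2 = y * s + 1 := by rw [hs]; linear_combination h7 / 4
    have h9 := h6.ne'
    field_simp
    linear_combination h8
  have heven : P.comp (-Polynomial.X) = P := by
    apply Polynomial.funext
    intro y
    obtain ⟨s, hs, rfl⟩ := hsurj y
    simpa [hk] using hneg s hs
  let M := -(S.underForm + S.underForm * S.underForm)
  let Q : Polynomial ℝ := (1 + (Polynomial.X : Polynomial ℝ) •
    (M.map (Int.cast : ℤ → ℝ)).map Polynomial.C).det
  have hsq : P * P = Polynomial.expand ℝ 2 Q := by
    apply Polynomial.funext
    intro y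
    obtain ⟨s, hs, rfl⟩ := hsurj y
    -- By evenness `P` may also be evaluated by way of `s⁻¹`. The product of the two expressions
    -- loses the unit factor.
    have h1 : P.eval (s - s⁻¹) = ((σ : ℤ) : ℝ) * s⁻¹ ^ k * (S.underMatrix (s⁻¹ ^ 2)).det := by
      rw [← hev _ (inv_ne_zero hs), inv_inv, ← neg_sub s, hneg s hs, hk, one_mul]
    have h2 : s ^ k * s⁻¹ ^ k = 1 := by
      rw [← mul_zpow, mul_inv_cancel₀ hs, one_zpow]
    have h3 : Q.eval ((s - s⁻¹) ^ 2) =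
        (1 + (s - s⁻¹) ^ 2 • M.map (Int.cast : ℤ → ℝ)).det := by
      simp only [Q]
      rw [← Polynomial.coe_evalRingHom, RingHom.map_det]
      congr 1
      ext i j
      simp [Matrix.one_apply, apply_ite]
    rw [Polynomial.expand_eval, h3, ← S.det_underMatrix_mul_det_underMatrix_inv hs,
      Polynomial.eval_mul]
    have h5 := hev s hs
    set E := P.eval (s - s⁻¹)
    set a := (S.underMatrix (s ^ 2)).det
    set b := (S.underMatrix (s⁻¹ ^ 2)).det
    linear_combination E * h1 + ((σ : ℤ) : ℝ) * s⁻¹ ^ k * b * h5 +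
      a * b * (s ^ k * s⁻¹ ^ k * hσ + h2)
  have hc0 : P.coeff 0 = 1 := by rw [Polynomial.coeff_zero_eq_eval_zero, hP0]
  have hc1 : P.coeff 1 = 0 := by
    have := congrArg (fun R => Polynomial.coeff R 1) heven
    rw [show (-Polynomial.X : Polynomial ℝ) = Polynomial.C (-1) * Polynomial.X by simp] at this
    simp only [Polynomial.comp_C_mul_X_coeff] at this
    linarith
  -- The coefficient of `z²` is `2 * P.coeff 2` on the left and the trace of `M` on the right.
  have hc2 := congrArg (fun R => Polynomial.coeff R 2) hsq
  have hQ : (Polynomial.expand ℝ 2 Q).coeff 2 = Q.coeff 1 :=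
    Polynomial.coeff_expand_mul (by norm_num) Q 1
  simp only [hQ, Q, Matrix.coeff_det_one_add_X_smul_one] at hc2
  rw [Polynomial.coeff_mul,
    show Finset.HasAntidiagonal.antidiagonal 2 = ({(0, 2), (1, 1), (2, 0)} : Finset (ℕ × ℕ)) from rfl] at hc2
  simp [hc0, hc1] at hc2
  have htr : (M.map (Int.cast : ℤ → ℝ)).trace = ((2 * S.pairing : ℤ) : ℝ) := by
    have h1 : M.trace = 2 * S.pairing := by
      simp only [M]
      rw [Matrix.trace_neg, trace_underForm]; ring
    rw [← h1]
    simp [Matrix.trace]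
  rw [htr] at hc2
  have hc3 : P.coeff 2 = (p.coeff 2 : ℝ) := by simp [hP]
  rw [hc3] at hc2
  have : p.coeff 2 + p.coeff 2 = 2 * S.pairing := by exact_mod_cast hc2
  omega

end ArrowSystem

/-! ### Existence and second coefficient of the Conway polynomial of a planar diagram -/

namespace GaussDiagram

variable {G : GaussDiagram}

theorem IsPlanar.det_overMatrix_eq (hG : G.IsPlanar) :
    (G.arrowSystem.overMatrix (LaurentPolynomial.T 1 : ℤ[T;T⁻¹])).det =
      (G.arrowSystem.underMatrix (LaurentPolynomial.T 1 : ℤ[T;T⁻¹])).det := by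
  obtain ⟨ν, hν⟩ := hG.exists_numbering.1
  exact ArrowSystem.det_overMatrix hν

/-- The determinant of the over-matrix of a planar diagram is symmetric up to a unit. -/
theorem IsPlanar.invert_det (hG : G.IsPlanar) : ∃ (k : ℤ) (σ : ℤˣ),
    LaurentPolynomial.invert (G.arrowSystem.overMatrix (LaurentPolynomial.T 1 : ℤ[T;T⁻¹])).det =
      LaurentPolynomial.C (σ : ℤ) * LaurentPolynomial.T k *
        (G.arrowSystem.overMatrix (LaurentPolynomial.T 1 : ℤ[T;T⁻¹])).det := by
  -- The duality by regions is available over fields, so it is applied in the fraction field and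
  -- pulled back.
  let ι := algebraMap ℤ[T;T⁻¹] (FractionRing ℤ[T;T⁻¹])
  have hι : Function.Injective ι := IsFractionRing.injective _ _
  let t : (ℤ[T;T⁻¹])ˣ := (LaurentPolynomial.isUnit_T 1).unit
  have ht : ∀ n : ℤ, ι (LaurentPolynomial.T n) = ι (LaurentPolynomial.T 1) ^ n := by
    intro n
    have h := congrArg Units.val ((Units.map (ι : ℤ[T;T⁻¹] →* FractionRing ℤ[T;T⁻¹])).map_zpow t n)
    rw [Units.val_zpow_eq_zpow_val, Units.coe_map, Units.coe_map,
      LaurentPolynomial.val_unit_T_zpow, one_mul] at h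
    exact h
  have h0 : ι (LaurentPolynomial.T 1) ≠ 0 := by
    rw [Ne, map_eq_zero_iff ι hι]
    exact (LaurentPolynomial.isUnit_T 1).ne_zero
  obtain ⟨k, σ, h⟩ := hG.exists_numbering.2 h0
  refine ⟨k, σ, hι ?_⟩
  have e1 : LaurentPolynomial.invert
      (G.arrowSystem.overMatrix (LaurentPolynomial.T 1 : ℤ[T;T⁻¹])).det =
      (G.arrowSystem.overMatrix (LaurentPolynomial.T (-1) : ℤ[T;T⁻¹])).det := by
    have := RingHom.map_det (LaurentPolynomial.invert (R := ℤ)).toRingEquiv.toRingHom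
      (G.arrowSystem.overMatrix (LaurentPolynomial.T 1 : ℤ[T;T⁻¹]))
    rw [RingHom.mapMatrix_apply, ArrowSystem.map_overMatrix] at this
    have h2 : (LaurentPolynomial.invert (R := ℤ)).toRingEquiv.toRingHom
      (LaurentPolynomial.T 1 : ℤ[T;T⁻¹]) = LaurentPolynomial.T (-1) :=
        LaurentPolynomial.invert_T 1
    rw [h2] at this
    exact this
  rw [e1, hG.det_overMatrix_eq, map_mul, map_mul, RingHom.map_det, RingHom.map_det,
    RingHom.mapMatrix_apply, RingHom.mapMatrix_apply, ArrowSystem.map_overMatrix,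
    ArrowSystem.map_underMatrix, ht (-1), ht k, zpow_neg_one, h]
  simp

theorem IsPlanar.exists_hasConwayPolynomial (hG : G.IsPlanar) :
    ∃ p, G.HasConwayPolynomial p := by
  obtain ⟨k, σ, h⟩ := hG.invert_det
  have h1 : ∃ δ : ℤˣ, LaurentPolynomial.eval₂ (Int.castRingHom ℤ) 1
      (G.arrowSystem.overMatrix (LaurentPolynomial.T 1 : ℤ[T;T⁻¹])).det = δ := by
    rw [hG.det_overMatrix_eq, ArrowSystem.map_det_underMatrix, Units.val_one,
      ArrowSystem.underMatrix_one]
    rcases G.arrowSystem.det_signMatrix (R := ℤ) with h | h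
    · exact ⟨1, h⟩
    · exact ⟨-1, h⟩
  obtain ⟨δ, hδ⟩ := h1
  obtain ⟨p, hp, u, hu⟩ := LaurentPolynomial.exists_conway h hδ
  obtain ⟨v, hv⟩ := G.exists_alexanderPolynomial_eq
  refine ⟨p, hp, u * Units.map LaurentPolynomial.square.toMonoidHom v⁻¹, ?_⟩
  change _ = _ * LaurentPolynomial.square _
  rw [hv, hu, map_mul, Units.val_mul, mul_assoc]
  congr 1
  change _ = LaurentPolynomial.square _ * _
  rw [← mul_assoc, ← map_mul, Units.inv_mul, map_one, one_mul]

theorem IsPlanar.coeff_two_eq_pairing (hG : G.IsPlanar) {p : Polynomial ℤ}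
    (hp : G.HasConwayPolynomial p) : p.coeff 2 = G.pairing := by
  obtain ⟨h0, u, hu⟩ := hp
  obtain ⟨v, hv⟩ := G.exists_alexanderPolynomial_eq
  rw [pairing_eq]
  refine G.arrowSystem.coeff_two_eq_pairing h0
    (u.isUnit.mul (v.isUnit.map LaurentPolynomial.square)) ?_
  rw [hu, hv, ← hG.det_overMatrix_eq, mul_assoc, ← map_mul]

end GaussDiagram

/-! ### Invariance of the arrow diagram pairing -/

theorem Passage.eq_of_upper_eq {p q : Passage} (hc : p.chord = q.chord) (hs : p.sign = q.sign)
    (hu : p.upper = q.upper) : p = q := by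
  cases p; cases q; simp_all

theorem Passage.eq_opp_of_upper_ne {p q : Passage} (hc : p.chord = q.chord) (hs : p.sign = q.sign)
    (hu : p.upper ≠ q.upper) : p = q.opp := by
  refine Passage.eq_of_upper_eq hc hs ?_
  rw [Passage.opp_upper]
  exact Bool.eq_not.2 hu

theorem Passage.opp_ne (p : Passage) : p.opp ≠ p := by
  intro h
  have := congrArg Passage.upper h
  simp [Passage.opp_upper] at this

theorem Passage.opp_injective : Function.Injective Passage.opp :=
  Function.LeftInverse.injective Passage.opp_opp

namespace GaussDiagram

/-- The pairing as a function of the Gauss word. -/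
def wordPairing (w : List Passage) : ℤ :=
  ∑ p ∈ w.toFinset, ∑ q ∈ w.toFinset,
    if p.upper = false ∧ q.upper = true ∧ [p, q, p.opp, q.opp].Sublist w then
      (p.sign : ℤ) * (q.sign : ℤ) else 0

/-- Arrows which do not contribute to the pairing may be removed. -/
theorem wordPairing_filter {w : List Passage} (g : ℕ → Bool)
    (h : ∀ p q : Passage, p.upper = false → q.upper = true →
      [p, q, p.opp, q.opp].Sublist w → g p.chord = true ∧ g q.chord = true) :
    wordPairing (w.filter fun p => g p.chord) = wordPairing w := by
  simp only [wordPairing, List.toFinset_filter, Finset.sum_filter]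
  refine Finset.sum_congr rfl fun p _ => ?_
  by_cases hp : g p.chord = true
  · rw [if_pos hp]
    refine Finset.sum_congr rfl fun q _ => ?_
    by_cases hq : g q.chord = true
    · rw [if_pos hq]
      refine if_congr (and_congr_right fun _ => and_congr_right fun _ => ⟨fun hs => ?_,
        fun hs => ?_⟩) rfl rfl
      · exact hs.trans List.filter_sublist
      · have := hs.filter fun p => g p.chord
        simpa [Passage.opp_chord, hp, hq] using this
    · rw [if_neg hq, if_neg]
      exact fun h' => hq (h p q h'.1 h'.2.1 h'.2.2).2
  · rw [if_neg hp]
    symm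
    refine Finset.sum_eq_zero fun q _ => if_neg ?_
    exact fun h' => hp (h p q h'.1 h'.2.1 h'.2.2).1

theorem wordPairing_relabel (f : Equiv.Perm ℕ) (w : List Passage) :
    wordPairing (w.map (Passage.relabel f)) = wordPairing w := by
  have hinj : Function.Injective (Passage.relabel f) := by
    intro p q h
    cases p; cases q
    simpa [Passage.relabel] using h
  have hset : (w.map (Passage.relabel f)).toFinset =
      w.toFinset.map ⟨Passage.relabel f, hinj⟩ := by
    ext p; simp
  simp only [wordPairing, hset, Finset.sum_map, Function.Embedding.coeFn_mk]
  refine Finset.sum_congr rfl fun p _ => Finset.sum_congr rfl fun q _ => ?_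
  refine if_congr (and_congr_right fun _ => and_congr_right fun _ => ?_) rfl rfl
  constructor
  · intro hs
    obtain ⟨l, hl, h⟩ := List.sublist_map_iff.1 hs
    have : [p, q, p.opp, q.opp] = l := List.map_injective_iff.2 hinj h
    rwa [this]
  · intro hs
    exact hs.map (Passage.relabel f)

/-! ### The three Reidemeister moves -/

section Moves

variable {G : GaussDiagram}

/-- Two tails at the beginning do not take part in the pairing. -/
theorem wordPairing_filter_of_upper_upper {x y : Passage} {r : List Passage}
    (hw : G.word = x :: y :: r) (hx : x.upper = true) (hy : y.upper = true) :
    wordPairing (G.word.filter fun p => p.chord ≠ x.chord ∧ p.chord ≠ y.chord) = G.pairing := by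
  have hnd := G.nodup
  rw [hw] at hnd
  simp only [List.nodup_cons, List.mem_cons, not_or] at hnd
  refine wordPairing_filter (fun c => decide (c ≠ x.chord ∧ c ≠ y.chord)) fun p q hp hq hs => ?_
  have hs' : [p, q, p.opp, q.opp].Sublist r := by
    rw [hw] at hs
    have h1 : p ≠ x := by rintro rfl; simp [hp] at hx
    have h2 : p ≠ y := by rintro rfl; simp [hp] at hy
    exact (List.Sublist.of_cons_of_ne h2
      (List.Sublist.of_cons_of_ne h1 hs))
  have hmem : ∀ z ∈ [p, q, p.opp, q.opp], z ∈ r := fun z hz => hs'.subset hz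
  -- If `p` or `q` belonged to the arrow with tail `z`, then `z` would be `p.opp` or `q`, both of
  -- which lie in `r`.
  have key : ∀ z ∈ G.word, z ∉ r → z.upper = true → p.chord ≠ z.chord ∧ q.chord ≠ z.chord := by
    intro z hz hzr hzu
    refine ⟨fun h => ?_, fun h => ?_⟩
    · have h1 : p ∈ G.word := by rw [hw]; simp [hmem p (by simp)]
      have h2 := Passage.eq_opp_of_upper_ne h (G.sign_eq p h1 z hz h) (by simp [hp, hzu])
      apply hzr
      rw [← Passage.opp_opp z, ← h2]
      exact hmem _ (by simp)
    · have h1 : q ∈ G.word := by rw [hw]; simp [hmem q (by simp)]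
      have h2 := Passage.eq_of_upper_eq h (G.sign_eq q h1 z hz h) (by simp [hq, hzu])
      apply hzr
      rw [← h2]
      exact hmem _ (by simp)
  have k1 := key x (by rw [hw]; simp) hnd.1.2 hx
  have k2 := key y (by rw [hw]; simp) hnd.2.1 hy
  simp [k1, k2]

theorem exists_passagePair_eq (s : ℤˣ) (x y : Passage) :
    ∃ x' y', passagePair s x y = [x', y'] ∧ (x' = x ∧ y' = y ∨ x' = y ∧ y' = x) := by
  unfold passagePair
  split_ifs
  · exact ⟨x, y, rfl, Or.inl ⟨rfl, rfl⟩⟩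
  · exact ⟨y, x, rfl, Or.inr ⟨rfl, rfl⟩⟩

theorem filter_passagePair (s : ℤˣ) {x : Passage} (y : Passage) (f : Passage → Bool)
    (hx : ¬ f x = true) : (passagePair s x y).filter f = [y].filter f := by
  unfold passagePair
  split_ifs <;> simp [List.filter_cons, hx]

/-- The top strand of a third move does not take part in the pairing. -/
theorem wordPairing_filter_of_passagePair {s : ℤˣ} {x y : Passage} {r : List Passage}
    (hw : G.word = passagePair s x y ++ r) (hx : x.upper = true) (hy : y.upper = true) :
    wordPairing (G.word.filter fun p => p.chord ≠ x.chord ∧ p.chord ≠ y.chord) = G.pairing := by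
  obtain ⟨x', y', h, ⟨rfl, rfl⟩ | ⟨rfl, rfl⟩⟩ := exists_passagePair_eq s x y
  · rw [h] at hw
    exact wordPairing_filter_of_upper_upper hw hx hy
  · rw [h] at hw
    rw [← wordPairing_filter_of_upper_upper hw hy hx]
    simp only [and_comm]

theorem chord_ne_of_mem {p z : Passage} (hp : p ∈ G.word) (hz : z ∈ G.word)
    (h1 : p ≠ z) (h2 : p ≠ z.opp) : p.chord ≠ z.chord := by
  intro h
  have hs := G.sign_eq p hp z hz h
  by_cases hu : p.upper = z.upper
  · exact h1 (Passage.eq_of_upper_eq h hs hu)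
  · exact h2 (Passage.eq_opp_of_upper_ne h hs hu)

/-- The ends of the kink's arrow are adjacent and come first, while in the pattern the ends of each
arrow are separated by an end of the other. -/
theorem pairing_one {H : GaussDiagram} {x : Passage} (hw : G.word = x :: x.opp :: H.word) :
    G.pairing = H.pairing := by
  have hnd := G.nodup
  rw [hw] at hnd
  simp only [List.nodup_cons, List.mem_cons, not_or] at hnd
  have hxG : x ∈ G.word := by rw [hw]; simp
  have h1 : G.word.filter (fun p => p.chord ≠ x.chord) = H.word := by
    rw [hw, List.filter_cons_of_neg (by simp), List.filter_cons_of_neg (by simp [Passage.opp_chord]),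
      List.filter_eq_self]
    intro p hp
    simp only [decide_eq_true_eq]
    refine G.chord_ne_of_mem (by rw [hw]; simp [hp]) hxG ?_ ?_
    · rintro rfl; exact hnd.1.2 hp
    · rintro rfl; exact hnd.2.1 hp
  have h2 := wordPairing_filter (w := G.word) (fun c => decide (c ≠ x.chord)) fun p q hp hq hs => ?_
  · rw [← show wordPairing G.word = G.pairing from rfl, ← h2, h1]
    rfl
  have hsub : ∀ z ∈ [p, q, p.opp, q.opp], z ∈ G.word := fun z hz => hs.subset hz
  have hn : [p, q, p.opp, q.opp].Nodup := hs.nodup G.nodup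
  simp only [List.nodup_cons, List.mem_cons, not_or, List.not_mem_nil] at hn
  rw [hw] at hs
  have hpx : p ≠ x := by
    rintro rfl
    have h3 := List.cons_sublist_cons.1 hs
    have h4 := List.Sublist.of_cons_of_ne hn.2.1.1 h3
    exact hnd.2.1 (h4.subset (by simp))
  have h3 := List.Sublist.of_cons_of_ne hpx hs
  have hpx' : p ≠ x.opp := by
    rintro rfl
    have := h3.subset (a := x) (by simp [Passage.opp_opp])
    simp only [List.mem_cons] at this
    tauto
  have hqx : q ≠ x := by
    rintro rfl
    have := h3.subset (a := q) (by simp)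
    simp only [List.mem_cons] at this
    tauto
  have hqx' : q ≠ x.opp := by
    rintro rfl
    have := h3.subset (a := x) (by simp [Passage.opp_opp])
    simp only [List.mem_cons] at this
    tauto
  have k1 := G.chord_ne_of_mem (hsub p (by simp)) hxG hpx hpx'
  have k2 := G.chord_ne_of_mem (hsub q (by simp)) hxG hqx hqx'
  simp [k1, k2]

/-- The base point lies just before the upper strand, so both arrows begin the word with their tails
and can be removed; what remains is the word after the move. -/
theorem pairing_two {H : GaussDiagram} {x y : Passage} {s : ℤˣ} {u v : List Passage}
    (hx : x.upper = true) (hy : y.upper = true)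
    (hw : G.word = [x, y] ++ u ++ passagePair s x.opp y.opp ++ v) (hH : H.word = u ++ v) :
    G.pairing = H.pairing := by
  have hw' : G.word = x :: y :: (u ++ passagePair s x.opp y.opp ++ v) := by rw [hw]; simp
  rw [← G.wordPairing_filter_of_upper_upper hw' hx hy]
  change _ = wordPairing H.word
  congr 1
  have hnd := G.nodup
  obtain ⟨x', y', h, h'⟩ := exists_passagePair_eq s x.opp y.opp
  have hself : (u ++ v).filter (fun p => p.chord ≠ x.chord ∧ p.chord ≠ y.chord) = u ++ v := by
    rw [List.filter_eq_self]
    intro p hp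
    have hpG : p ∈ G.word := by
      rw [hw]
      simp only [List.mem_append] at hp ⊢
      tauto
    rw [hw, h] at hnd
    simp only [List.nodup_append, List.mem_append, List.mem_cons, List.not_mem_nil, or_false,
      List.nodup_cons] at hnd hp
    obtain ⟨⟨⟨-, -, n1⟩, -, n2⟩, -, n3⟩ := hnd
    have hne : p ≠ x ∧ p ≠ y ∧ p ≠ x' ∧ p ≠ y' := by
      rcases hp with hp | hp
      · exact ⟨(n1 _ (Or.inl rfl) _ hp).symm, (n1 _ (Or.inr rfl) _ hp).symm,
          n2 _ (Or.inr hp) _ (Or.inl rfl), n2 _ (Or.inr hp) _ (Or.inr rfl)⟩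
      · exact ⟨(n3 _ (Or.inl (Or.inl (Or.inl rfl))) _ hp).symm,
          (n3 _ (Or.inl (Or.inl (Or.inr rfl))) _ hp).symm,
          (n3 _ (Or.inr (Or.inl rfl)) _ hp).symm, (n3 _ (Or.inr (Or.inr rfl)) _ hp).symm⟩
    have hne' : p ≠ x.opp ∧ p ≠ y.opp := by
      rcases h' with ⟨rfl, rfl⟩ | ⟨rfl, rfl⟩ <;> tauto
    have k1 := G.chord_ne_of_mem hpG (z := x) (by rw [hw]; simp) hne.1 hne'.1
    have k2 := G.chord_ne_of_mem hpG (z := y) (by rw [hw]; simp) hne.2.1 hne'.2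
    simp [k1, k2]
  rw [hH, ← hself, hw, h]
  rcases h' with ⟨rfl, rfl⟩ | ⟨rfl, rfl⟩ <;>
    simp [List.filter_append, Passage.opp_chord]

end Moves

/-! ### Moving the base point -/

/-- The contribution of a passage to the index of the arrows which separate it from its opposite
passage. -/
def indexSign (p : Passage) : ℤ := (if p.upper then 1 else -1) * p.sign

theorem indexSign_opp (p : Passage) : indexSign p.opp = -indexSign p := by
  rcases p with ⟨c, _ | _, s⟩ <;> simp [indexSign, Passage.opp]

/-- A Gauss word all of whose arrows have index zero. -/
structure IsBalanced (w : List Passage) : Prop where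
  nodup : w.Nodup
  opp_mem : ∀ p ∈ w, p.opp ∈ w
  sum_eq_zero : (w.map indexSign).sum = 0
  index_eq_zero : ∀ (x u y : List Passage) (p : Passage), w = x ++ p :: u ++ p.opp :: y →
    (u.map indexSign).sum = 0

/-- Only the arrow ending at the base point changes its arc, to the complementary one. The total sum
is zero and the two ends of the arrow cancel, so this arc also has sum zero. -/
theorem IsBalanced.rotate_one {p : Passage} {w : List Passage} (h : IsBalanced (p :: w)) :
    IsBalanced (w ++ [p]) where
  nodup := by
    have := h.nodup
    rw [List.nodup_cons] at this
    rw [List.nodup_append_comm]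
    simpa using this
  opp_mem q hq := by
    have := h.opp_mem q (by simpa [or_comm] using hq)
    simpa [or_comm] using this
  sum_eq_zero := by
    have := h.sum_eq_zero
    simp only [List.map_cons, List.sum_cons, List.map_append, List.map_nil, List.sum_append,
      List.sum_nil] at this ⊢
    omega
  index_eq_zero x u y q hq := by
    rcases List.eq_nil_or_concat y with rfl | ⟨y', r, rfl⟩
    · have hq' : w ++ [p] = (x ++ q :: u) ++ [q.opp] := hq
      obtain ⟨rfl, hp⟩ := List.append_inj' hq' rfl
      simp only [List.cons.injEq, and_true] at hp
      subst hp
      have h1 := h.index_eq_zero [] x u q.opp (by simp [Passage.opp_opp])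
      have h2 := h.sum_eq_zero
      simp only [List.map_cons, List.sum_cons, List.map_append, List.sum_append, h1,
        indexSign_opp] at h2
      omega
    · have hq' : w ++ [p] = (x ++ q :: u ++ q.opp :: y') ++ [r] := by simpa using hq
      obtain ⟨rfl, -⟩ := List.append_inj' hq' rfl
      exact h.index_eq_zero (p :: x) u y' q (by simp)

theorem triple_sublist_iff {b r c : Passage} {u v : List Passage} (hu : r ∉ u) (hv : r ∉ v) :
    [b, r, c].Sublist (u ++ r :: v) ↔ b ∈ u ∧ c ∈ v := by
  constructor
  · intro h
    obtain ⟨l₁, l₂, hl, h₁, h₂⟩ := List.sublist_append_iff.1 h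
    cases l₁ with
    | nil =>
      simp only [List.nil_append] at hl
      subst hl
      by_cases hb : b = r
      · subst hb
        exact absurd ((List.cons_sublist_cons.1 h₂).subset (by simp)) hv
      · exact absurd ((List.Sublist.of_cons_of_ne hb h₂).subset (by simp)) hv
    | cons b' l₁ =>
      simp only [List.cons_append, List.cons.injEq] at hl
      obtain ⟨rfl, hl⟩ := hl
      cases l₁ with
      | nil =>
        simp only [List.nil_append] at hl
        subst hl
        exact ⟨h₁.subset (by simp), (List.cons_sublist_cons.1 h₂).subset (by simp)⟩
      | cons r' l₁ =>
        simp only [List.cons_append, List.cons.injEq] at hl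
        obtain ⟨rfl, hl⟩ := hl
        exact absurd (h₁.subset (by simp)) hu
  · rintro ⟨hb, hc⟩
    exact (List.singleton_sublist.2 hb).append (List.cons_sublist_cons.2
      (List.singleton_sublist.2 hc))

theorem sublist_concat_iff {p : Passage} {l w : List Passage} (h : p ∉ l) :
    l.Sublist (w ++ [p]) ↔ l.Sublist w := by
  refine ⟨fun hs => ?_, fun hs => hs.trans (List.sublist_append_left _ _)⟩
  obtain ⟨l₁, l₂, rfl, h₁, h₂⟩ := List.sublist_append_iff.1 hs
  have : l₂ = [] := by
    rcases List.sublist_singleton.1 h₂ with rfl | rfl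
    · rfl
    · simp at h
  simpa [this] using h₁

theorem sublist_cons_iff_of_notMem {p : Passage} {l w : List Passage} (h : p ∉ l) :
    l.Sublist (p :: w) ↔ l.Sublist w := by
  refine ⟨fun hs => ?_, fun hs => hs.cons p⟩
  cases hs with
  | cons _ hs => exact hs
  | cons_cons _ hs => simp at h

theorem mem_of_sublist_concat {p z : Passage} {l w : List Passage}
    (hs : (z :: l).Sublist (w ++ [p])) (hl : l ≠ []) : z ∈ w := by
  obtain ⟨l₁, l₂, h, h₁, h₂⟩ := List.sublist_append_iff.1 hs
  cases l₁ with
  | nil =>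
    simp only [List.nil_append] at h
    subst h
    have := h₂.length_le
    simp [hl] at this
  | cons z' l₁ =>
    simp only [List.cons_append, List.cons.injEq] at h
    rw [h.1]
    exact h₁.subset (by simp)

/-- The pattern begins and ends with a head, so moving a tail past the base point changes nothing.
Moving a head `p` loses the pairs in which `p` comes first and gains those in which it comes last.
The difference is `p.sign` times the signed count of arrows crossing that of `p`, which is its index
up to sign. -/
theorem IsBalanced.wordPairing_rotate_one {p : Passage} {w : List Passage}
    (h : IsBalanced (p :: w)) : wordPairing (w ++ [p]) = wordPairing (p :: w) := by
  have hpw : p ∉ w := (List.nodup_cons.1 h.nodup).1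
  have hset : (w ++ [p]).toFinset = (p :: w).toFinset := by
    ext q; simp
  unfold wordPairing
  rw [hset]
  by_cases hpu : p.upper = true
  · refine Finset.sum_congr rfl fun a _ => Finset.sum_congr rfl fun b _ => ?_
    refine if_congr (and_congr_right fun ha => and_congr_right fun hb => ?_) rfl rfl
    have hap : a ≠ p := by rintro rfl; simp [ha] at hpu
    have hbp : b.opp ≠ p := by rintro rfl; simp [Passage.opp_upper, hb] at hpu
    constructor
    · intro hs
      by_cases hmem : p ∈ [a, b, a.opp, b.opp]
      · exfalso
        obtain ⟨l₁, l₂, hl, h₁, h₂⟩ := List.sublist_append_iff.1 hs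
        rcases List.sublist_singleton.1 h₂ with rfl | rfl
        · rw [List.append_nil] at hl
          rw [hl] at hmem
          exact hpw (h₁.subset hmem)
        · have := congrArg List.getLast? hl
          simp at this
          exact hbp this
      · rw [sublist_cons_iff_of_notMem hmem]
        exact (sublist_concat_iff hmem).1 hs
    · intro hs
      exact (List.Sublist.of_cons_of_ne hap hs).trans (List.sublist_append_left _ _)
  · have hpl : p.upper = false := by simpa using hpu
    have hpo : p.opp.upper = true := by simp [Passage.opp_upper, hpl]
    set A := (p :: w).toFinset
    let X : Passage → ℤ := fun b => if b.upper = true ∧ [b, p.opp, b.opp].Sublist w then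
      (p.sign * b.sign : ℤ) else 0
    let Y : Passage → ℤ := fun a => if a.upper = false ∧ [a, p.opp, a.opp].Sublist w then
      (a.sign * p.sign : ℤ) else 0
    have key : ∀ a b : Passage,
        (if a.upper = false ∧ b.upper = true ∧ [a, b, a.opp, b.opp].Sublist (p :: w) then
          (a.sign * b.sign : ℤ) else 0) -
        (if a.upper = false ∧ b.upper = true ∧ [a, b, a.opp, b.opp].Sublist (w ++ [p]) then
          (a.sign * b.sign : ℤ) else 0) =
        (if a = p then X b else 0) - if b = p.opp then Y a else 0 := by
      intro a b
      by_cases ha : a = p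
      · subst ha
        have h1 : ¬ (a.upper = false ∧ b.upper = true ∧ [a, b, a.opp, b.opp].Sublist (w ++ [a])) :=
          fun hs => hpw (mem_of_sublist_concat hs.2.2 (by simp))
        have h2 : Y a = 0 := if_neg fun h' => hpw (h'.2.subset (by simp))
        rw [if_pos rfl, h2, ite_self, if_neg h1, sub_zero, sub_zero]
        simp only [X, List.cons_sublist_cons, hpl, true_and]
      · rw [if_neg ha]
        by_cases hb : b = p.opp
        · subst hb
          have h1 : ¬ (a.upper = false ∧ p.opp.upper = true ∧
              [a, p.opp, a.opp, p.opp.opp].Sublist (p :: w)) := fun hs =>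
            hpw ((List.Sublist.of_cons_of_ne ha hs.2.2).subset
              (by simp [Passage.opp_opp]))
          rw [if_pos rfl, if_neg h1]
          congr 1
          refine if_congr (and_congr_right fun ha' => ?_) (by rw [Passage.opp_sign]) rfl
          rw [Passage.opp_opp]
          refine ⟨fun hs => ?_, fun hs => ⟨hpo, hs.append (List.Sublist.refl [p])⟩⟩
          have := hs.2
          rw [show [a, p.opp, a.opp, p] = [a, p.opp, a.opp] ++ [p] from rfl] at this
          exact (List.append_sublist_append_right _).1 this
        · rw [if_neg hb, sub_zero, sub_eq_zero]
          refine if_congr (and_congr_right fun ha' => and_congr_right fun hb' => ?_) rfl rfl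
          have hmem : p ∉ [a, b, a.opp, b.opp] := by
            simp only [List.mem_cons, List.not_mem_nil, or_false, not_or]
            refine ⟨fun e => ha e.symm, ?_, ?_, ?_⟩
            · rintro rfl; simp [hb'] at hpl
            · intro e
              rw [e, Passage.opp_upper, ha'] at hpl
              simp at hpl
            · intro e
              rw [e, Passage.opp_opp] at hb
              exact hb rfl
          rw [sublist_cons_iff_of_notMem hmem, sublist_concat_iff hmem]
    rw [eq_comm, ← sub_eq_zero, ← Finset.sum_sub_distrib]
    simp only [← Finset.sum_sub_distrib, key]
    have hpA : p ∈ A := by simp [A]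
    have hpoA : p.opp ∈ A := by simpa [A] using h.opp_mem p (by simp)
    have hpow : p.opp ∈ w := by
      have := h.opp_mem p (by simp)
      simpa [p.opp_ne] using this
    have e1 : ∑ a ∈ A, ∑ b ∈ A, ((if a = p then X b else 0) - if b = p.opp then Y a else 0) =
        ∑ b ∈ A, (X b - Y b) := by
      simp only [Finset.sum_sub_distrib]
      congr 1
      · rw [Finset.sum_comm]
        refine Finset.sum_congr rfl fun b _ => ?_
        rw [Finset.sum_ite_eq' A p, if_pos hpA]
      · refine Finset.sum_congr rfl fun b _ => ?_
        rw [Finset.sum_ite_eq' A p.opp, if_pos hpoA]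
    rw [e1]
    obtain ⟨u, v, rfl⟩ := List.append_of_mem hpow
    have hnd := h.nodup
    simp only [List.nodup_cons, List.nodup_append, List.mem_append, List.mem_cons, not_or] at hnd
    obtain ⟨⟨hpu', -, hpv'⟩, hun, ⟨hov, hvn⟩, hdis⟩ := hnd
    have hou : p.opp ∉ u := fun h' => hdis _ h' _ (Or.inl rfl) rfl
    -- Both kinds of pair have one end of the other arrow between `p` and `p.opp`: its tail in a
    -- lost pair, its head in a gained one.
    have e2 : ∀ b, X b - Y b = p.sign * if b ∈ u ∧ b.opp ∈ v then indexSign b else 0 := by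
      intro b
      simp only [X, Y, triple_sublist_iff hou hov, indexSign]
      by_cases hb : b ∈ u ∧ b.opp ∈ v
      · rcases hbu : b.upper with _ | _ <;> simp [hb, mul_comm]
      · simp [hb]
    simp only [e2, ← Finset.mul_sum]
    have hUA : u.toFinset ⊆ A := by
      intro b hb
      simp only [A, List.mem_toFinset, List.mem_cons, List.mem_append] at hb ⊢
      tauto
    have e3 : ∑ b ∈ A, (if b ∈ u ∧ b.opp ∈ v then indexSign b else 0) =
        ∑ b ∈ u.toFinset, if b.opp ∈ v then indexSign b else 0 := by
      rw [← Finset.sum_subset hUA]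
      · refine Finset.sum_congr rfl fun b hb => ?_
        rw [List.mem_toFinset] at hb
        simp [hb]
      · intro b _ hb
        rw [List.mem_toFinset] at hb
        simp [hb]
    have e4 : ∑ b ∈ u.toFinset, indexSign b = 0 := by
      rw [List.sum_toFinset _ hun]
      exact h.index_eq_zero [] u v p (by simp)
    -- Arrows with both ends on the arc contribute zero to the index.
    have e5 : ∑ b ∈ u.toFinset, (if b.opp ∈ u then indexSign b else 0) = 0 := by
      rw [← Finset.sum_filter]
      refine Finset.sum_involution (fun b _ => b.opp) ?_ ?_ ?_ ?_
      · intro b _; rw [indexSign_opp]; ring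
      · intro b _ _; exact b.opp_ne
      · intro b hb
        simp only [Finset.mem_filter, List.mem_toFinset, Passage.opp_opp] at hb ⊢
        exact hb.symm
      · intro b _; exact b.opp_opp
    have e6 : ∀ b ∈ u.toFinset, (if b.opp ∈ v then indexSign b else 0) =
        indexSign b - if b.opp ∈ u then indexSign b else 0 := by
      intro b hb
      rw [List.mem_toFinset] at hb
      have h1 := h.opp_mem b (by simp [hb])
      simp only [List.mem_cons, List.mem_append] at h1
      have h2 : b.opp ≠ p := by
        rintro rfl
        rw [Passage.opp_opp] at hou
        exact hou hb
      have h3 : b.opp ≠ p.opp := fun e => hpu' (Passage.opp_injective e ▸ hb)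
      by_cases h4 : b.opp ∈ u
      · have h5 : b.opp ∉ v := fun h' => hdis _ h4 _ (Or.inr h') rfl
        simp [h4, h5]
      · have h5 : b.opp ∈ v := by tauto
        simp [h4, h5]
    rw [e3, Finset.sum_congr rfl e6, Finset.sum_sub_distrib, e4, e5]
    simp

theorem IsBalanced.wordPairing_rotate {u v : List Passage} (h : IsBalanced (u ++ v)) :
    wordPairing (v ++ u) = wordPairing (u ++ v) := by
  induction u generalizing v with
  | nil => simp
  | cons p u ih =>
    have h1 : IsBalanced (u ++ (v ++ [p])) := by
      have := h.rotate_one (p := p) (w := u ++ v)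
      simpa using this
    have h2 := ih h1
    have h3 := h.wordPairing_rotate_one (p := p) (w := u ++ v)
    simp only [List.append_assoc, List.cons_append, List.nil_append] at h2 h3 ⊢
    rw [h2, h3]

/-- The numbering drops by `indexSign` at each passage. -/
theorem sum_indexSign {G : GaussDiagram} {ν : ℕ → ℤ} (hν : G.arrowSystem.IsNumbering ν)
    (x u y : List Passage) (hw : G.word = x ++ u ++ y) :
    (u.map indexSign).sum = ν x.length - ν (x.length + u.length) := by
  induction u generalizing x with
  | nil => simp
  | cons p u ih =>
    have hx : x.length < G.word.length := by rw [hw]; simp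
    have hp : G.word.get ⟨x.length, hx⟩ = p := by
      simp [hw]
    have h1 := ih (x ++ [p]) (by simp [hw])
    have h2 : ν (x.length + 1) = ν x.length - indexSign p := by
      rcases hu : p.upper with _ | _
      · have h3 := hν.2.2.1 ⟨⟨x.length, hx⟩, by rw [hp, hu]⟩
        have h4 := hν.1 ⟨⟨x.length, hx⟩, by rw [hp, hu]⟩
        simp only [arrowSystem, hp] at h3 h4
        rw [indexSign, hu, h3, h4]
        simp
      · have h3 := hν.2.1 ⟨G.mate ⟨x.length, hx⟩, by
          rw [G.get_mate, Passage.opp_upper, hp, hu]; rfl⟩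
        simp only [arrowSystem, G.mate_mate] at h3
        rw [G.get_mate, hp, Passage.opp_sign] at h3
        rw [indexSign, hu, h3]
        simp
    simp only [List.length_append, List.length_cons, List.length_nil, List.map_cons, List.sum_cons]
      at h1 ⊢
    rw [h1]
    rw [show x.length + (0 + 1) = x.length + 1 by omega, h2,
      show x.length + 1 + u.length = x.length + (u.length + 1) by omega]
    ring

/-- The numbering agrees on the edge leaving one end of an arrow and the edge arriving at the other,
so the drop along the arc between them is zero. -/
theorem isBalanced_of_isNumbering {G : GaussDiagram} {ν : ℕ → ℤ}
    (hν : G.arrowSystem.IsNumbering ν) : IsBalanced G.word where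
  nodup := G.nodup
  opp_mem := G.opp_mem
  sum_eq_zero := by
    have := sum_indexSign hν [] G.word [] (by simp)
    simpa [hν.2.2.2] using this
  index_eq_zero x u y p hw := by
    have h := sum_indexSign hν (x ++ [p]) u (p.opp :: y) (by simp [hw])
    rw [h]
    have hx : x.length < G.word.length := by rw [hw]; simp
    have hp : G.word.get ⟨x.length, hx⟩ = p := by simp [hw]
    have hy : x.length + 1 + u.length < G.word.length := by rw [hw]; simp; omega
    have hpo : G.word.get ⟨x.length + 1 + u.length, hy⟩ = p.opp := by
      exact List.getElem_of_append (l₁ := x ++ p :: u) hw (by simp; omega)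
    have hm : G.mate ⟨x.length, hx⟩ = ⟨x.length + 1 + u.length, hy⟩ := by
      rw [eq_comm, ← G.get_eq_opp_iff, hp, hpo]
    have hm' : G.mate ⟨x.length + 1 + u.length, hy⟩ = ⟨x.length, hx⟩ := by
      rw [← hm, G.mate_mate]
    simp only [List.length_append, List.length_cons, List.length_nil, zero_add]
    rcases hu : p.upper with _ | _
    · have h3 := hν.2.1 ⟨⟨x.length, hx⟩, by rw [hp, hu]⟩
      have h4 := hν.2.2.1 ⟨⟨x.length, hx⟩, by rw [hp, hu]⟩
      simp only [arrowSystem, hm] at h3 h4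
      rw [h3, h4]; ring
    · have h3 := hν.1 ⟨⟨x.length + 1 + u.length, hy⟩, by rw [hpo, Passage.opp_upper, hu]; rfl⟩
      simp only [arrowSystem, hm'] at h3
      rw [h3]; ring

theorem IsPlanar.isBalanced {G : GaussDiagram} (hG : G.IsPlanar) : IsBalanced G.word := by
  obtain ⟨ν, hν⟩ := hG.exists_numbering.1
  exact isBalanced_of_isNumbering hν

theorem IsPlanar.pairing_eq_of_move {G H : GaussDiagram} (hG : G.IsPlanar)
    (h : ReidemeisterMove G.word H.word) : G.pairing = H.pairing := by
  generalize hw : G.word = w at h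
  generalize hw' : H.word = w' at h
  cases h with
  | rotate u v =>
    have := hG.isBalanced
    rw [hw] at this
    change wordPairing G.word = wordPairing H.word
    rw [hw, hw', this.wordPairing_rotate]
  | relabel f w =>
    change wordPairing G.word = wordPairing H.word
    rw [hw, hw', wordPairing_relabel]
  | one c o ε w =>
    exact pairing_one (x := ⟨c, o, ε⟩) (by rw [hw, hw']; rfl)
  | two c d ε s u v =>
    exact pairing_two (x := ⟨c, true, ε⟩) (y := ⟨d, true, -ε⟩) (s := s) rfl rfl hw hw'
  | three a b c εa εb εc s₁ s₂ s₃ u v w h₁ h₂ =>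
    have e1 := wordPairing_filter_of_passagePair (G := G) (s := s₁) (x := ⟨a, true, εa⟩)
      (y := ⟨b, true, εb⟩) (r := _) (by rw [hw]; simp only [List.append_assoc]; rfl) rfl rfl
    have e2 := wordPairing_filter_of_passagePair (G := H) (s := -s₁) (x := ⟨a, true, εa⟩)
      (y := ⟨b, true, εb⟩) (r := _) (by rw [hw']; simp only [List.append_assoc]; rfl) rfl rfl
    rw [← e1, ← e2, hw, hw']
    simp only [List.filter_append]
    congr 1
    -- Once `a` and `b` are removed, each strand keeps at most one point, an end of `c`, so the
    -- orders on the strands no longer matter. The same holds in the next case.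
    rw [filter_passagePair s₁ _ _ (by simp), filter_passagePair s₂ _ _ (by simp),
      filter_passagePair s₃ _ _ (by simp), filter_passagePair (-s₁) _ _ (by simp),
      filter_passagePair (-s₂) _ _ (by simp), filter_passagePair (-s₃) _ _ (by simp)]
  | threeSwap a b c εa εb εc s₁ s₂ s₃ u v w h₁ h₂ =>
    have e1 := wordPairing_filter_of_passagePair (G := G) (s := s₁) (x := ⟨a, true, εa⟩)
      (y := ⟨b, true, εb⟩) (r := _) (by rw [hw]; simp only [List.append_assoc]; rfl) rfl rfl
    have e2 := wordPairing_filter_of_passagePair (G := H) (s := -s₁) (x := ⟨a, true, εa⟩)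
      (y := ⟨b, true, εb⟩) (r := _) (by rw [hw']; simp only [List.append_assoc]; rfl) rfl rfl
    rw [← e1, ← e2, hw, hw']
    simp only [List.filter_append]
    congr 1
    rw [filter_passagePair s₁ _ _ (by simp), filter_passagePair s₂ _ _ (by simp),
      filter_passagePair s₃ _ _ (by simp), filter_passagePair (-s₁) _ _ (by simp),
      filter_passagePair (-s₂) _ _ (by simp), filter_passagePair (-s₃) _ _ (by simp)]

end GaussDiagram

/-! ### Invariance of the pairing and the theorem -/

theorem Knot.pairing_eq {K : Knot} {G H : GaussDiagram} (hG : G.IsDiagramOf K)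
    (hH : H.IsDiagramOf K) : G.pairing = H.pairing := by
  obtain ⟨hG, rfl⟩ := hG
  obtain ⟨hH, h⟩ := hH
  have := Quot.eqvGen_exact h
  clear h
  have key : ∀ D E : KnotDiagram,
      Relation.EqvGen (fun D E : KnotDiagram => ReidemeisterMove D.1.word E.1.word) D E →
      D.1.pairing = E.1.pairing := by
    intro D E h
    induction h with
    | rel D E h => exact D.2.pairing_eq_of_move h
    | refl D => rfl
    | symm D E _ ih => exact ih.symm
    | trans D E F _ _ ih ih' => exact ih.trans ih'
  exact (key _ _ this).symm

theorem theorem1 (K : Knot) (G : GaussDiagram) (hG : G.IsDiagramOf K) :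
    K.casson = G.pairing := by
  -- Existence for `G` makes the choice of Conway polynomial a genuine one. The chosen polynomial
  -- may come from another diagram `H`, to which the pairing is transported.
  obtain ⟨p, hp⟩ := hG.1.exists_hasConwayPolynomial
  obtain ⟨H, hH, hq⟩ := Classical.epsilon_spec
    (p := fun p => ∃ G : GaussDiagram, G.IsDiagramOf K ∧ G.HasConwayPolynomial p) ⟨p, G, hG, hp⟩
  rw [Knot.pairing_eq hG hH]
  exact hH.1.coeff_two_eq_pairing hq
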